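/- For a bounded domain (nonempty connected open set) $D\subset\mathbb C^n$ let $L^2_h(D)$ be the space of holomorphic functions on $D$ that are square integrable for Lebesgue measure $dV$, and let $K_D$ be its Bergman kernel: $K_D(\cdot,w)\in L^2_h(D)$ and $f(w)=\int_D f(z)\overline{K_D(z,w)}\,dV(z)$ for all $f\in L^2_h(D)$ and $w\in D$. For $p\in D$ and $\xi\in\mathbb C^n$ the Bergman metric is $$F_B^D(p,\xi)=\Bigl(\sum_{\nu,\mu=1}^n\frac{\partial^2\log K_D(z,z)}{\partial z_\nu\,\partial\bar z_\mu}\Big|_{z=p}\,\xi_\nu\bar\xi_\mu\Bigr)^{1/2}.$$ **Proposition 4.1.** Let $n\ge 2$, let $\Omega\subset\mathbb C^n$ be a bounded domain, and let $K$ be a domain whose closure $\overline K$ is a compact subset of $\Omega$, such that $\Omega\setminus\overline K$ is connected. Then the Bergman metrics of $\Omega$ and of the domain $\Omega\setminus\overline K$ are well defined (the kernel exists and is positive on the diagonal, $\log K_D(z,z)$ is of class $C^2$, and the sum above is nonnegative), and there is a constant $d\in(0,1)$, depending only on $\Omega$ and $K$, such that for all $z\in\Omega\setminus\overline K$ and all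 $\xi\in\mathbb C^n$ $$\sqrt{1-d^2}\,F_B^{\Omega}(z,\xi)\le F_B^{\Omega\setminus\overline K}(z,\xi)\le\frac1{\sqrt{1-d^2}}\,F_B^{\Omega}(z,\xi).$$ In particular, the Bergman metric of $\Omega\setminus\overline K$ does not blow up near the inner boundary $\partial K$: there are an open set $U\supset\partial K$ and a constant $C$ such that $F_B^{\Omega\setminus\overline K}(z,\xi)\le C\,\|\xi\|$ for all $z\in U\cap(\Omega\setminus\overline K)$ and all $\xi\in\mathbb C^n$. -/

import Mathlib

open MeasureTheory

noncomputable section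

/-- The space `L²_h(Ω)` of functions that are holomorphic in `Ω ⊆ ℂⁿ` and square integrable over `Ω`
with respect to Lebesgue measure (the values outside `Ω` are irrelevant). -/
def bergmanSpace {n : ℕ} (Ω : Set (Fin n → ℂ)) : Set ((Fin n → ℂ) → ℂ) :=
  {f | DifferentiableOn ℂ f Ω ∧ MemLp f 2 (volume.restrict Ω)}

/-- `k` is a reproducing kernel of `L²_h(Ω)`: for every `w ∈ Ω`, the function `k(·, w)` lies in
`L²_h(Ω)` and `f(w) = ∫_Ω f(z) conj (k(z, w)) dV(z)` for all `f ∈ L²_h(Ω)`. These conditions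
determine the values of `k` on `Ω × Ω`. -/
def IsBergmanKernel {n : ℕ} (Ω : Set (Fin n → ℂ)) (k : (Fin n → ℂ) → (Fin n → ℂ) → ℂ) : Prop :=
  ∀ w ∈ Ω, (fun z => k z w) ∈ bergmanSpace Ω ∧
    ∀ f ∈ bergmanSpace Ω, f w = ∫ z in Ω, f z * (starRingEnd ℂ) (k z w)

/-- The Bergman kernel `K_Ω(z, w)`. -/
def bergmanKernel {n : ℕ} (Ω : Set (Fin n → ℂ)) : (Fin n → ℂ) → (Fin n → ℂ) → ℂ :=
  Classical.epsilon (IsBergmanKernel Ω)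

/-- The function `z ↦ log K_Ω(z, z)`; note that `K_Ω(z, z)` is real. -/
def logBergman {n : ℕ} (Ω : Set (Fin n → ℂ)) (z : Fin n → ℂ) : ℝ :=
  Real.log (bergmanKernel Ω z z).re

/-- The Wirtinger derivative `∂f/∂z_ν = (∂f/∂x_ν - i ∂f/∂y_ν) / 2`. -/
def wirtinger {n : ℕ} (ν : Fin n) (f : (Fin n → ℂ) → ℂ) (p : Fin n → ℂ) : ℂ :=
  (fderiv ℝ f p (Pi.single ν 1) - Complex.I * fderiv ℝ f p (Pi.single ν Complex.I)) / 2

/-- The Wirtinger derivative `∂f/∂z̄_μ = (∂f/∂x_μ + i ∂f/∂y_μ) / 2`. -/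
def wirtingerBar {n : ℕ} (μ : Fin n) (f : (Fin n → ℂ) → ℂ) (p : Fin n → ℂ) : ℂ :=
  (fderiv ℝ f p (Pi.single μ 1) + Complex.I * fderiv ℝ f p (Pi.single μ Complex.I)) / 2

/-- The Levi form `∑_{ν,μ} ∂²u/∂z_ν∂z̄_μ (p) ξ_ν conj(ξ_μ)` of a real function `u`. It is real when
`u` is twice continuously differentiable near `p`. -/
def leviForm {n : ℕ} (u : (Fin n → ℂ) → ℝ) (p ξ : Fin n → ℂ) : ℝ :=
  (∑ ν, ∑ μ, wirtinger ν (wirtingerBar μ (fun z => (u z : ℂ))) p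
    * ξ ν * (starRingEnd ℂ) (ξ μ)).re

/-- The Bergman metric `F_B^Ω(p, ξ)`, the square root of the Levi form of `log K_Ω(z, z)`. -/
def bergmanMetric {n : ℕ} (Ω : Set (Fin n → ℂ)) (p ξ : Fin n → ℂ) : ℝ :=
  Real.sqrt (leviForm (logBergman Ω) p ξ)

/-- The Bergman metric of `Ω` is well defined: the Bergman kernel exists, it is positive on the
diagonal, `log K_Ω(z, z)` is twice continuously differentiable in `Ω`, and its Levi form is
nonnegative. -/
def HasBergmanMetric {n : ℕ} (Ω : Set (Fin n → ℂ)) : Prop :=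
  IsBergmanKernel Ω (bergmanKernel Ω) ∧
  (∀ z ∈ Ω, (bergmanKernel Ω z z).im = 0 ∧ 0 < (bergmanKernel Ω z z).re) ∧
  ContDiffOn ℝ 2 (logBergman Ω) Ω ∧
  ∀ z ∈ Ω, ∀ ξ : Fin n → ℂ, 0 ≤ leviForm (logBergman Ω) z ξ

end

/-! Write `D` for `Ω \ closure K`. Restriction `T` from the Bergman space of `Ω` to that of `D` is a
bounded bijection. It is injective by the identity theorem. It is surjective by Hartogs' theorem
(this is where `2 ≤ n` enters), and the extension stays square integrable because only a compact
subset of `Ω` is added. By the open mapping theorem the inverse is bounded too, so ‖L ∘ T‖ ≤ ‖L‖ ≤ C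
‖L ∘ T‖ for every functional L on the Bergman space of `D`.

Let e(z) be evaluation at z, a holomorphic map into the dual of the Bergman space. Then K(z,z) =
‖e(z)‖², and the Levi form of log ‖e‖² is a Gram quotient. Hence the metric equals dist(e'(z)ξ, ℂ
e(z)) / ‖e(z)‖ (`exists_bergmanMetric_eq`). Evaluation on `Ω` and its derivative at points of `D`
are those of `D` composed with `T`, so numerator and denominator are comparable and the two metrics
differ at most by the factor C (`exists_bergmanMetric_comparison`). On a compact subset of `Ω` the
metric of `Ω` is at most ‖e'(z)ξ‖ / ‖e(z)‖, hence bounded by a multiple of ‖ξ‖, and comparison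
carries this bound over to `D` near the inner boundary. -/

noncomputable section

/-! ### Holomorphic maps on normed spaces: Cauchy estimates, limits, smoothness, identity theorem.
-/

section SeveralComplexVariables

open Metric Filter Set
open scoped Topology

variable {E F : Type*} [NormedAddCommGroup E] [NormedSpace ℂ E] [NormedAddCommGroup F]
  [NormedSpace ℂ F]

/-- Cauchy's estimate for the Fréchet derivative of a bounded holomorphic function on a ball. -/
theorem norm_fderiv_le_of_norm_le {f : E → F} {z : E} {r M : ℝ} (hr : 0 < r)
    (hf : DifferentiableOn ℂ f (ball z r)) (hM : ∀ x ∈ ball z r, ‖f x‖ ≤ M) :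
    ‖fderiv ℂ f z‖ ≤ 2 * M / r := by
  refine Complex.norm_fderiv_le_div_of_mapsTo_ball hf (fun x hx => ?_) hr
  rw [mem_closedBall, dist_eq_norm]
  have h1 := hM x hx
  have h2 := hM z (mem_ball_self hr)
  linarith [norm_sub_le (f x) (f z)]

/-- The derivative of a bounded holomorphic function is Lipschitz on a smaller ball. -/
theorem norm_fderiv_sub_fderiv_le {f : E → F} {c : E} {r M : ℝ} (hr : 0 < r)
    (hf : DifferentiableOn ℂ f (ball c (3 * r))) (hM : ∀ x ∈ ball c (3 * r), ‖f x‖ ≤ M)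
    {z w : E} (hz : z ∈ ball c r) (hw : w ∈ ball c r) :
    ‖fderiv ℂ f w - fderiv ℂ f z‖ ≤ 4 * M / r ^ 2 * ‖w - z‖ := by
  have hd : ∀ x ∈ ball c (3 * r), DifferentiableAt ℂ f x := fun x hx =>
    hf.differentiableAt (isOpen_ball.mem_nhds hx)
  have hDf : ∀ x ∈ ball c (2 * r), ‖fderiv ℂ f x‖ ≤ 2 * M / r := by
    intro x hx
    have hsub : ball x r ⊆ ball c (3 * r) :=
      ball_subset_ball' (by rw [mem_ball] at hx; linarith)
    exact norm_fderiv_le_of_norm_le hr (hf.mono hsub) fun y hy => hM y (hsub hy)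
  have hmem : ∀ x ∈ ball z r, x ∈ ball c (2 * r) ∧ x + (w - z) ∈ ball c (2 * r) := by
    intro x hx
    simp only [mem_ball, dist_eq_norm] at hx hz hw ⊢
    constructor
    · calc ‖x - c‖ = ‖(x - z) + (z - c)‖ := by congr 1; abel
        _ ≤ _ := norm_add_le _ _
        _ < _ := by linarith
    · calc ‖x + (w - z) - c‖ = ‖(x - z) + (w - c)‖ := by congr 1; abel
        _ ≤ _ := norm_add_le _ _
        _ < _ := by linarith
  have h23 : ball c (2 * r) ⊆ ball c (3 * r) := ball_subset_ball (by linarith)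
  -- The Cauchy estimate is applied to the increment of `f` by the fixed vector `w - z`. By the mean
  -- value inequality this increment is already O(‖w - z‖), so no second derivative is needed.
  have hg : ∀ x ∈ ball z r,
      HasFDerivAt (fun x => f (x + (w - z)) - f x) (fderiv ℂ f (x + (w - z)) - fderiv ℂ f x) x := by
    intro x hx
    have h1 := (hd _ (h23 (hmem x hx).1)).hasFDerivAt
    have h2 := (hd _ (h23 (hmem x hx).2)).hasFDerivAt
    exact ((hasFDerivAt_comp_add_right (w - z)).2 h2).sub h1
  have hgM : ∀ x ∈ ball z r, ‖f (x + (w - z)) - f x‖ ≤ 2 * M / r * ‖w - z‖ := by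
    intro x hx
    have := (convex_ball c (2 * r)).norm_image_sub_le_of_norm_fderiv_le
      (fun y hy => hd y (h23 hy)) hDf (hmem x hx).1 (hmem x hx).2
    simpa using this
  have key := norm_fderiv_le_of_norm_le hr
    (fun x hx => (hg x hx).differentiableAt.differentiableWithinAt) hgM
  rw [(hg z (mem_ball_self hr)).fderiv] at key
  rw [add_sub_cancel] at key
  refine key.trans (le_of_eq ?_)
  field_simp
  ring

/-- A uniform second order Taylor estimate for bounded holomorphic functions. -/
theorem norm_sub_sub_fderiv_le {f : E → F} {c : E} {r M : ℝ} (hr : 0 < r)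
    (hf : DifferentiableOn ℂ f (ball c (3 * r))) (hM : ∀ x ∈ ball c (3 * r), ‖f x‖ ≤ M)
    {z w : E} (hz : z ∈ ball c r) (hw : w ∈ ball c r) :
    ‖f w - f z - fderiv ℂ f z (w - z)‖ ≤ 4 * M / r ^ 2 * ‖w - z‖ ^ 2 := by
  have hM0 : 0 ≤ M := (norm_nonneg _).trans (hM c (mem_ball_self (by linarith)))
  have hconv : Convex ℝ (ball c r ∩ closedBall z ‖w - z‖) :=
    (convex_ball c r).inter (convex_closedBall z _)
  have := hconv.norm_image_sub_le_of_norm_fderiv_le' (f := f) (φ := fderiv ℂ f z) (𝕜 := ℂ)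
    (C := 4 * M / r ^ 2 * ‖w - z‖) (x := z) (y := w)
    (fun x hx => hf.differentiableAt
      (isOpen_ball.mem_nhds (ball_subset_ball (by linarith) hx.1)))
    (fun x hx => (norm_fderiv_sub_fderiv_le hr hf hM hz hx.1).trans (by
      have := hx.2
      rw [mem_closedBall, dist_eq_norm] at this
      gcongr)) ⟨hz, by simp⟩ ⟨hw, by simp [dist_eq_norm]⟩
  rwa [mul_assoc, ← pow_two] at this

/-- A holomorphic function on an open set is bounded near every point. -/
theorem DifferentiableOn.exists_ball_norm_le {f : E → F} {U : Set E} (hU : IsOpen U)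
    (hf : DifferentiableOn ℂ f U) {x : E} (hx : x ∈ U) :
    ∃ r > 0, ∃ M, ball x (3 * r) ⊆ U ∧ ∀ y ∈ ball x (3 * r), ‖f y‖ ≤ M := by
  have h1 : ∀ᶠ y in 𝓝 x, ‖f y‖ < ‖f x‖ + 1 :=
    (hf.differentiableAt (hU.mem_nhds hx)).continuousAt.norm.eventually_lt_const (by linarith)
  obtain ⟨ε, hε, h⟩ := Metric.mem_nhds_iff.1 (Filter.inter_mem h1 (hU.mem_nhds hx))
  refine ⟨ε / 3, by positivity, ‖f x‖ + 1, ?_, ?_⟩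
  · rw [mul_div_cancel₀ _ (by norm_num)]; exact fun y hy => (h hy).2
  · rw [mul_div_cancel₀ _ (by norm_num)]; exact fun y hy => (h hy).1.le

variable [CompleteSpace F]

/-- A uniform limit of holomorphic functions on a ball is holomorphic at the centre. -/
theorem differentiableAt_of_tendstoUniformlyOn_ball {f : ℕ → E → F} {g : E → F} {c : E} {r : ℝ}
    (hr : 0 < r) (hf : ∀ n, DifferentiableOn ℂ (f n) (ball c r))
    (hlim : TendstoUniformlyOn f g atTop (ball c r)) : DifferentiableAt ℂ g c := by
  have hhalf : ∀ x ∈ ball c (r / 2), ball x (r / 2) ⊆ ball c r := fun x hx =>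
    ball_subset_ball' (by rw [mem_ball] at hx; linarith)
  have hd : ∀ n, ∀ x ∈ ball c r, DifferentiableAt ℂ (f n) x := fun n x hx =>
    (hf n).differentiableAt (isOpen_ball.mem_nhds hx)
  -- Cauchy's estimate on balls of radius `r / 2` turns uniform closeness of the functions into
  -- uniform closeness of the derivatives.
  have hcs : UniformCauchySeqOn (fun n => fderiv ℂ (f n)) atTop (ball c (r / 2)) := by
    rw [Metric.uniformCauchySeqOn_iff]
    intro ε hε
    obtain ⟨N, hN⟩ := Metric.uniformCauchySeqOn_iff.1 hlim.uniformCauchySeqOn (ε * r / 8)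
      (by positivity)
    refine ⟨N, fun m hm n hn x hx => ?_⟩
    have h1 : ‖fderiv ℂ (fun y => f m y - f n y) x‖ ≤ 2 * (ε * r / 8) / (r / 2) := by
      refine norm_fderiv_le_of_norm_le (half_pos hr) (((hf m).mono (hhalf x hx)).sub
        ((hf n).mono (hhalf x hx))) fun y hy => ?_
      rw [← dist_eq_norm]
      exact (hN m hm n hn y (hhalf x hx hy)).le
    have hx' : x ∈ ball c r := hhalf x hx (mem_ball_self (half_pos hr))
    rw [fderiv_fun_sub (hd m x hx') (hd n x hx')] at h1
    rw [dist_eq_norm]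
    refine h1.trans_lt ?_
    have : 2 * (ε * r / 8) / (r / 2) = ε / 2 := by field_simp; ring
    rw [this]; linarith
  have hex : ∀ x, ∃ L : E →L[ℂ] F, x ∈ ball c (r / 2) →
      Tendsto (fun n => fderiv ℂ (f n) x) atTop (𝓝 L) := by
    intro x
    by_cases hx : x ∈ ball c (r / 2)
    · obtain ⟨L, hL⟩ := cauchySeq_tendsto_of_complete (hcs.cauchySeq hx)
      exact ⟨L, fun _ => hL⟩
    · exact ⟨0, fun h => absurd h hx⟩
  choose g' hg' using hex
  exact (hasFDerivAt_of_tendstoUniformlyOn isOpen_ball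
    (hcs.tendstoUniformlyOn_of_tendsto fun x hx => hg' x hx)
    (fun n x hx => (hd n x (hhalf x hx (mem_ball_self (half_pos hr)))).hasFDerivAt)
    (fun x hx => hlim.tendsto_at (hhalf x hx (mem_ball_self (half_pos hr))))
    (mem_ball_self (half_pos hr))).differentiableAt

/-- Directional derivatives of holomorphic functions are holomorphic. -/
theorem DifferentiableOn.fderiv_apply_of_complex {f : E → F} {U : Set E} (hU : IsOpen U)
    (hf : DifferentiableOn ℂ f U) (v : E) : DifferentiableOn ℂ (fun z => fderiv ℂ f z v) U := by
  intro x hx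
  refine DifferentiableAt.differentiableWithinAt ?_
  obtain ⟨r, hr, M, hsub, hM⟩ := hf.exists_ball_norm_le hU hx
  have hM0 : 0 ≤ M := (norm_nonneg _).trans (hM x (mem_ball_self (by linarith)))
  -- Steps `t k` of size at most `s` keep `z + t k • v` in the ball of radius `r`. The difference
  -- quotients are holomorphic in `z` and converge uniformly by the Taylor estimate.
  set s : ℝ := r / (2 * (‖v‖ + 1)) with hs
  have hs0 : 0 < s := by positivity
  have hsv : s * ‖v‖ < r / 2 := by
    rw [hs, div_mul_eq_mul_div, div_lt_div_iff₀ (by positivity) (by norm_num)]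
    nlinarith [norm_nonneg v]
  let t : ℕ → ℂ := fun k => ((s / (k + 1) : ℝ) : ℂ)
  have ht0 : ∀ k, t k ≠ 0 := fun k => by
    simp only [t, Ne, Complex.ofReal_eq_zero]; positivity
  have htn : ∀ k, ‖t k‖ = s / (k + 1) := fun k => by
    simp only [t]; rw [Complex.norm_real, Real.norm_of_nonneg (by positivity)]
  have htle : ∀ k, ‖t k‖ ≤ s := fun k => by
    rw [htn]; exact div_le_self hs0.le (by linarith [(Nat.cast_nonneg k : (0 : ℝ) ≤ k)])
  have htz : Tendsto (fun k => ‖t k‖) atTop (𝓝 0) := by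
    simp_rw [htn]
    simpa [div_eq_mul_inv] using tendsto_one_div_add_atTop_nhds_zero_nat.const_mul s
  have hmem : ∀ k, ∀ z ∈ ball x (r / 2), z ∈ ball x r ∧ z + t k • v ∈ ball x r := by
    intro k z hz
    refine ⟨ball_subset_ball (by linarith) hz, ?_⟩
    rw [mem_ball, dist_eq_norm] at hz ⊢
    calc ‖z + t k • v - x‖ = ‖(z - x) + t k • v‖ := by congr 1; abel
      _ ≤ ‖z - x‖ + ‖t k‖ * ‖v‖ := (norm_add_le _ _).trans_eq (by rw [norm_smul])
      _ < r := by nlinarith [htle k, norm_nonneg v]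
  have h13 : ball x r ⊆ U := (ball_subset_ball (by linarith)).trans hsub
  refine differentiableAt_of_tendstoUniformlyOn_ball (r := r / 2)
    (f := fun k z => (t k)⁻¹ • (f (z + t k • v) - f z)) (half_pos hr) (fun k z hz => ?_) ?_
  · have h1 := hf.differentiableAt (hU.mem_nhds (h13 (hmem k z hz).1))
    have h2 := hf.differentiableAt (hU.mem_nhds (h13 (hmem k z hz).2))
    exact (((differentiableAt_comp_add_right (t k • v)).2 h2).sub h1).const_smul _
      |>.differentiableWithinAt
  · rw [Metric.tendstoUniformlyOn_iff]
    intro ε hε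
    have hlim : Tendsto (fun k => 4 * M / r ^ 2 * ‖v‖ ^ 2 * ‖t k‖) atTop (𝓝 0) := by
      simpa using htz.const_mul (4 * M / r ^ 2 * ‖v‖ ^ 2)
    filter_upwards [hlim.eventually_lt_const hε] with k hk z hz
    refine lt_of_le_of_lt ?_ hk
    have := norm_sub_sub_fderiv_le hr (hf.mono hsub) hM (hmem k z hz).1 (hmem k z hz).2
    rw [add_sub_cancel_left, map_smul] at this
    rw [dist_comm, dist_eq_norm]
    have e : (t k)⁻¹ • (f (z + t k • v) - f z) - (fderiv ℂ f z) v
        = (t k)⁻¹ • (f (z + t k • v) - f z - t k • (fderiv ℂ f z) v) := by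
      rw [smul_sub (t k)⁻¹ (f (z + t k • v) - f z), smul_smul, inv_mul_cancel₀ (ht0 k), one_smul]
    have hn : 0 < ‖t k‖ := norm_pos_iff.2 (ht0 k)
    rw [e, norm_smul, norm_inv, inv_mul_le_iff₀ hn]
    refine this.trans (le_of_eq ?_)
    rw [norm_smul]; ring

/-- Holomorphic functions of several variables are smooth. -/
theorem DifferentiableOn.contDiffOn_of_complex [FiniteDimensional ℂ E] {U : Set E} (hU : IsOpen U)
    (n : ℕ) : ∀ {f : E → F}, DifferentiableOn ℂ f U → ContDiffOn ℂ n f U := by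
  induction n with
  | zero => intro f hf; exact contDiffOn_zero.2 hf.continuousOn
  | succ n ih =>
    intro f hf
    rw [Nat.cast_succ, contDiffOn_succ_iff_fderiv_of_isOpen hU]
    refine ⟨hf, by simp, contDiffOn_clm_apply.2 fun v => ih (hf.fderiv_apply_of_complex hU v)⟩

/-- The identity theorem for holomorphic functions of several variables. -/
theorem DifferentiableOn.eqOn_zero_of_eventuallyEq_zero {f : E → F} {U : Set E}
    (hU : IsOpen U) (hUc : IsPreconnected U) (hf : DifferentiableOn ℂ f U) {z₀ : E} (hz₀ : z₀ ∈ U)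
    (h0 : f =ᶠ[𝓝 z₀] 0) : ∀ z ∈ U, f z = 0 := by
  have key : U ⊆ {z | f =ᶠ[𝓝 z] 0} := by
    refine hUc.subset_of_closure_inter_subset isOpen_setOfPred_eventually_nhds ⟨z₀, hz₀, h0⟩ ?_
    rintro z ⟨hzc, hzU⟩
    obtain ⟨r, hr, hsub⟩ := Metric.isOpen_iff.1 hU z hzU
    obtain ⟨s, hs, hsz⟩ := Metric.mem_closure_iff.1 hzc r hr
    rw [dist_comm] at hsz
    refine eventuallyEq_of_mem (ball_mem_nhds z hr) fun w hw => ?_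
    -- The complex line through `s` and `w` meets the ball in a convex set, where the one-variable
    -- identity theorem applies.
    let φ : ℂ → E := fun t => s + t • (w - s)
    have hφ : Differentiable ℂ φ := by fun_prop
    have hφ0 : φ 0 = s := by simp [φ]
    have hφ1 : φ 1 = w := by simp [φ]
    have hconv : Convex ℝ (φ ⁻¹' ball z r) := by
      intro a ha b hb p q hp hq hpq
      have := convex_ball z r ha hb hp hq hpq
      rw [mem_preimage]
      convert this using 1
      simp only [φ, smul_add, add_smul]
      rw [add_add_add_comm, ← add_smul p q s, hpq, one_smul, smul_assoc, smul_assoc]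
    have han : AnalyticOnNhd ℂ (f ∘ φ) (φ ⁻¹' ball z r) :=
      ((hf.mono hsub).comp hφ.differentiableOn fun t ht => ht).analyticOnNhd
        (isOpen_ball.preimage hφ.continuous)
    have h00 : (f ∘ φ) =ᶠ[𝓝 0] 0 := by
      have : Tendsto φ (𝓝 0) (𝓝 s) := hφ0 ▸ hφ.continuous.tendsto 0
      exact this.eventually hs
    have := han.eqOn_zero_of_preconnected_of_eventuallyEq_zero hconv.isPreconnected
      (z₀ := 0) (by rw [mem_preimage, hφ0]; exact hsz) h00 (x := 1)
      (by rw [mem_preimage, hφ1]; exact hw)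
    simpa [hφ1] using this
  exact fun z hz => (key hz).self_of_nhds

end SeveralComplexVariables

/-! ### Mean value property and pointwise bounds by the L² norm. -/

section MeanValue

open Metric Set

variable {n : ℕ}

/-- Multiplication by a complex number of modulus one preserves Lebesgue measure on `ℂⁿ`. -/
theorem measurePreserving_circle_smul (a : Circle) :
    MeasurePreserving (fun w : Fin n → ℂ => (a : ℂ) • w) volume volume := by
  have h : ∀ _ : Fin n, MeasurePreserving (fun z : ℂ => (a : ℂ) * z) volume volume := fun _ =>
    (rotation a).measurePreserving
  exact volume_preserving_pi h

/-- The mean value property of holomorphic functions on balls of `ℂⁿ`. -/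
theorem setIntegral_closedBall_eq_of_differentiableOn {f : (Fin n → ℂ) → ℂ} {U : Set (Fin n → ℂ)}
    {c : Fin n → ℂ} {r : ℝ} (hU : IsOpen U) (hf : DifferentiableOn ℂ f U)
    (hr : closedBall c r ⊆ U) :
    ∫ w in closedBall (0 : Fin n → ℂ) r, f (c + w) =
      (volume.real (closedBall (0 : Fin n → ℂ) r) : ℂ) * f c := by
  set B := closedBall (0 : Fin n → ℂ) r with hB
  have hmem : ∀ w ∈ B, ∀ t : ℂ, ‖t‖ ≤ 1 → c + t • w ∈ U := by
    intro w hw t ht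
    apply hr
    rw [hB, mem_closedBall_zero_iff] at hw
    rw [mem_closedBall, dist_eq_norm, add_sub_cancel_left, norm_smul]
    nlinarith [norm_nonneg w, norm_nonneg t]
  -- Balls here are polydiscs (sup norm); only their invariance under unit scalars matters.
  -- Averaging over θ and exchanging integrals reduces the claim to the mean value property on
  -- circles.
  have hrot : ∀ θ : ℝ, ∫ w in B, f (c + circleMap 0 1 θ • w) = ∫ w in B, f (c + w) := by
    intro θ
    have hmp := measurePreserving_circle_smul (n := n) (Circle.exp θ)
    have hemb : MeasurableEmbedding fun w : Fin n → ℂ => (Circle.exp θ : ℂ) • w :=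
      (Homeomorph.smulOfNeZero (Circle.exp θ : ℂ) (Circle.coe_ne_zero _)).measurableEmbedding
    have := hmp.setIntegral_preimage_emb hemb (fun w => f (c + w)) B
    have hpre : (fun w : Fin n → ℂ => (Circle.exp θ : ℂ) • w) ⁻¹' B = B := by
      ext w
      rw [mem_preimage, hB, mem_closedBall_zero_iff, mem_closedBall_zero_iff, norm_smul,
        Circle.norm_coe, one_mul]
    rw [hpre] at this
    simpa [circleMap, Circle.coe_exp] using this
  have hcirc : ∀ w ∈ B, ∫ θ in (0 : ℝ)..2 * Real.pi, f (c + circleMap 0 1 θ • w)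
      = (2 * Real.pi : ℝ) * f c := by
    intro w hw
    have hd : ∀ t ∈ closedBall (0 : ℂ) 1, DifferentiableAt ℂ (fun t : ℂ => f (c + t • w)) t := by
      intro t ht
      have h1 := hf.differentiableAt (hU.mem_nhds (hmem w hw t (mem_closedBall_zero_iff.1 ht)))
      exact h1.comp t (by fun_prop : DifferentiableAt ℂ (fun t : ℂ => c + t • w) t)
    have hdc : DiffContOnCl ℂ (fun t : ℂ => f (c + t • w)) (ball 0 |1|) := by
      rw [abs_one]
      refine DifferentiableOn.diffContOnCl fun t ht => ?_
      rw [closure_ball _ one_ne_zero] at ht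
      exact (hd t ht).differentiableWithinAt
    have h := hdc.circleAverage
    rw [Real.circleAverage, zero_smul, add_zero, inv_smul_eq_iff₀ (by positivity)] at h
    rw [h, Complex.real_smul]
  have hcont : ContinuousOn (fun p : ℝ × (Fin n → ℂ) => f (c + circleMap 0 1 p.1 • p.2))
      (Icc 0 (2 * Real.pi) ×ˢ B) := by
    refine hf.continuousOn.comp (Continuous.continuousOn ?_) fun p hp => ?_
    · exact continuous_const.add (((continuous_circleMap 0 1).comp continuous_fst).smul
        continuous_snd)
    · exact hmem p.2 hp.2 _ (by simp)
  have hint : Integrable (fun p : ℝ × (Fin n → ℂ) => f (c + circleMap 0 1 p.1 • p.2))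
      ((volume.restrict (Ioc 0 (2 * Real.pi))).prod (volume.restrict B)) := by
    rw [Measure.prod_restrict]
    exact (hcont.integrableOn_compact (isCompact_Icc.prod (isCompact_closedBall _ _))).mono_set
      (prod_mono Ioc_subset_Icc_self subset_rfl)
  have hswap := integral_integral_swap (f := fun (θ : ℝ) (w : Fin n → ℂ) =>
    f (c + circleMap 0 1 θ • w)) hint
  simp_rw [hrot, ← intervalIntegral.integral_of_le Real.two_pi_pos.le] at hswap
  rw [setIntegral_congr_fun isClosed_closedBall.measurableSet (fun w hw => hcirc w hw),
    intervalIntegral.integral_const, setIntegral_const, sub_zero, Complex.real_smul,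
    Complex.real_smul] at hswap
  have h2pi : ((2 * Real.pi : ℝ) : ℂ) ≠ 0 := by exact_mod_cast Real.two_pi_pos.ne'
  apply mul_left_cancel₀ h2pi
  rw [hswap]; ring

/-- Pointwise values of square integrable holomorphic functions are controlled by the `L²` norm. -/
theorem volume_closedBall_mul_norm_sq_le {f : (Fin n → ℂ) → ℂ} {U : Set (Fin n → ℂ)}
    {c : Fin n → ℂ} {r : ℝ} (hU : IsOpen U) (hf : f ∈ bergmanSpace U) (hr : closedBall c r ⊆ U) :
    volume.real (closedBall (0 : Fin n → ℂ) r) * ‖f c‖ ^ 2 ≤ ∫ z in U, ‖f z‖ ^ 2 := by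
  -- Using the holomorphic function f² instead of f gives the L² bound without Cauchy–Schwarz.
  have hmv := setIntegral_closedBall_eq_of_differentiableOn hU (hf.1.pow 2) hr
  have hnorm := congrArg norm hmv
  have hint : IntegrableOn (fun z => ‖f z‖ ^ 2) U :=
    (memLp_two_iff_integrable_sq_norm hf.2.1).1 hf.2
  simp only [Pi.pow_apply, norm_mul, norm_pow, Complex.norm_real,
    Real.norm_of_nonneg measureReal_nonneg] at hnorm
  rw [← hnorm]
  refine (norm_integral_le_integral_norm _).trans ?_
  simp only [norm_pow]
  have hmp := measurePreserving_add_left (volume : Measure (Fin n → ℂ)) c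
  have := hmp.setIntegral_preimage_emb (Homeomorph.addLeft c).measurableEmbedding
    (fun w => ‖f w‖ ^ 2) (closedBall c r)
  have hpre : (fun w => c + w) ⁻¹' closedBall c r = closedBall (0 : Fin n → ℂ) r := by
    ext w; simp [dist_eq_norm]
  rw [hpre] at this
  rw [this]
  exact setIntegral_mono_set hint (Filter.Eventually.of_forall fun z => by positivity)
    hr.eventuallyLE

end MeanValue

/-! ### Weak holomorphy implies norm holomorphy. -/

section WeaklyHolomorphic

open Metric Filter Set
open scoped Topology

variable {E H : Type*} [NormedAddCommGroup E] [NormedSpace ℂ E] [NormedAddCommGroup H]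
  [NormedSpace ℂ H]

/-- A locally bounded family of functionals that is pointwise holomorphic is holomorphic. -/
theorem differentiableOn_strongDual_of_apply {e : E → StrongDual ℂ H} {U : Set E} (hU : IsOpen U)
    (he : ∀ g, DifferentiableOn ℂ (fun z => e z g) U)
    (hb : ∀ c ∈ U, ∃ M, ∀ᶠ z in 𝓝 c, ‖e z‖ ≤ M) : DifferentiableOn ℂ e U := by
  intro c hc
  obtain ⟨M, hM⟩ := hb c hc
  obtain ⟨ε, hε, hball⟩ := Metric.mem_nhds_iff.1 (Filter.inter_mem hM (hU.mem_nhds hc))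
  obtain ⟨r, hr, rfl⟩ : ∃ r > 0, 3 * r = ε := ⟨ε / 3, by positivity, by ring⟩
  have hM0 : 0 ≤ M := (norm_nonneg _).trans (hball (mem_ball_self hε)).1
  have hsub : ball c (3 * r) ⊆ U := fun z hz => (hball hz).2
  have hbd : ∀ g, ∀ z ∈ ball c (3 * r), ‖e z g‖ ≤ M * ‖g‖ := fun g z hz =>
    (e z).le_of_opNorm_le (hball hz).1 g
  have hd : ∀ g, DifferentiableAt ℂ (fun z => e z g) c := fun g =>
    (he g).differentiableAt (hU.mem_nhds hc)
  let L : E →L[ℂ] StrongDual ℂ H :=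
    LinearMap.mkContinuous₂ (LinearMap.mk₂ ℂ (fun v g => fderiv ℂ (fun z => e z g) c v)
      (fun v w g => map_add _ _ _) (fun a v g => map_smul _ _ _)
      (fun v g h => by
        simp only [map_add]
        rw [fderiv_fun_add (hd g) (hd h)]; rfl)
      (fun a v g => by
        simp only [map_smul]
        rw [fderiv_fun_const_smul (hd g)]; rfl)) (2 * M / (3 * r)) (fun v g => by
        have h1 := norm_fderiv_le_of_norm_le hε ((he g).mono hsub) (hbd g)
        refine (ContinuousLinearMap.le_of_opNorm_le _ h1 v).trans (le_of_eq ?_)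
        ring)
  have hL : ∀ v g, L v g = fderiv ℂ (fun z => e z g) c v := fun v g => rfl
  -- The Taylor remainder of each `e z g` is bounded linearly in ‖g‖, so the estimate holds in the
  -- operator norm.
  have key : ∀ z ∈ ball c r, ‖e z - e c - L (z - c)‖ ≤ 4 * M / r ^ 2 * ‖‖z - c‖ ^ 2‖ := by
    intro z hz
    refine ContinuousLinearMap.opNorm_le_bound _ (by positivity) fun g => ?_
    have := norm_sub_sub_fderiv_le hr ((he g).mono hsub) (hbd g) (mem_ball_self hr) hz
    rw [← hL] at this
    refine this.trans (le_of_eq ?_)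
    rw [Real.norm_of_nonneg (by positivity)]; ring
  refine HasFDerivAt.differentiableAt (f' := L) ?_ |>.differentiableWithinAt
  rw [hasFDerivAt_iff_isLittleO]
  refine (Asymptotics.IsBigO.of_bound (4 * M / r ^ 2) ?_).trans_isLittleO
    (Asymptotics.isLittleO_pow_sub_sub c one_lt_two)
  exact eventually_of_mem (ball_mem_nhds c hr) key

end WeaklyHolomorphic

/-! ### The Bergman space as a Hilbert space, with its evaluation functionals. -/

section BergmanHilbert

open Metric Filter Set
open scoped Topology InnerProductSpace ComplexConjugate

variable {n : ℕ} {Ω : Set (Fin n → ℂ)}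

/-- The Bergman space of `Ω` as a subspace of `L²(Ω)`. -/
def bergmanSubmodule (Ω : Set (Fin n → ℂ)) : Submodule ℂ (Lp ℂ 2 (volume.restrict Ω)) where
  carrier := {g | ∃ f, DifferentiableOn ℂ f Ω ∧ f =ᵐ[volume.restrict Ω] g}
  add_mem' := by
    rintro a b ⟨f, hf, hfa⟩ ⟨g, hg, hgb⟩
    exact ⟨f + g, hf.add hg, (hfa.add hgb).trans (Lp.coeFn_add a b).symm⟩
  zero_mem' := ⟨0, differentiableOn_const 0, (Lp.coeFn_zero _ _ _).symm⟩
  smul_mem' := by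
    rintro c a ⟨f, hf, hfa⟩
    exact ⟨c • f, hf.const_smul c, (hfa.const_smul c).trans (Lp.coeFn_smul c a).symm⟩

theorem mem_bergmanSpace_of_ae_eq {f : (Fin n → ℂ) → ℂ} {g : Lp ℂ 2 (volume.restrict Ω)}
    (hf : DifferentiableOn ℂ f Ω) (hfg : f =ᵐ[volume.restrict Ω] g) : f ∈ bergmanSpace Ω :=
  ⟨hf, (memLp_congr_ae hfg).2 (Lp.memLp g)⟩

/-- The class in the Bergman space of a square integrable holomorphic function. -/
def toBergman {f : (Fin n → ℂ) → ℂ} (hf : f ∈ bergmanSpace Ω) : bergmanSubmodule Ω :=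
  ⟨hf.2.toLp f, f, hf.1, hf.2.coeFn_toLp.symm⟩

theorem toBergman_ae_eq {f : (Fin n → ℂ) → ℂ} (hf : f ∈ bergmanSpace Ω) :
    f =ᵐ[volume.restrict Ω] (toBergman hf : Lp ℂ 2 (volume.restrict Ω)) :=
  hf.2.coeFn_toLp.symm

/-- The `L²` norm through a representative. -/
theorem setIntegral_norm_sq_eq_of_ae_eq {f : (Fin n → ℂ) → ℂ} {g : Lp ℂ 2 (volume.restrict Ω)}
    (hfg : f =ᵐ[volume.restrict Ω] g) : ∫ z in Ω, ‖f z‖ ^ 2 = ‖g‖ ^ 2 := by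
  rw [← inner_self_eq_norm_sq (𝕜 := ℂ) g, L2.inner_def]
  have h1 : ∫ z, ⟪g z, g z⟫_ℂ ∂(volume.restrict Ω) = ∫ z in Ω, ((‖f z‖ ^ 2 : ℝ) : ℂ) := by
    refine integral_congr_ae ?_
    filter_upwards [hfg] with z hz
    rw [← hz, inner_self_eq_norm_sq_to_K]; simp
  rw [h1, integral_complex_ofReal]
  simp

/-- Evaluation is locally uniformly bounded on the Bergman space. -/
theorem norm_apply_le_of_closedBall_subset (hΩ : IsOpen Ω) {r : ℝ} (hr : 0 < r) :
    ∃ C : ℝ, 0 ≤ C ∧ ∀ z, closedBall z r ⊆ Ω → ∀ (f : (Fin n → ℂ) → ℂ)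
      (g : Lp ℂ 2 (volume.restrict Ω)), DifferentiableOn ℂ f Ω → f =ᵐ[volume.restrict Ω] g →
      ‖f z‖ ≤ C * ‖g‖ := by
  have hv : 0 < volume.real (closedBall (0 : Fin n → ℂ) r) :=
    ENNReal.toReal_pos (measure_closedBall_pos _ _ hr).ne' measure_closedBall_lt_top.ne
  refine ⟨(Real.sqrt (volume.real (closedBall (0 : Fin n → ℂ) r)))⁻¹, by positivity,
    fun z hz f g hf hfg => ?_⟩
  have h := volume_closedBall_mul_norm_sq_le hΩ (mem_bergmanSpace_of_ae_eq hf hfg) hz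
  rw [setIntegral_norm_sq_eq_of_ae_eq hfg] at h
  have hs := Real.sqrt_pos.2 hv
  rw [inv_mul_eq_div, le_div_iff₀ hs]
  refine abs_le_of_sq_le_sq' ?_ (norm_nonneg g) |>.2
  rw [mul_pow, Real.sq_sqrt hv.le]
  linarith

/-- The bound on evaluations makes L² convergence locally uniform, so the pointwise limit is
holomorphic. An a.e. convergent subsequence identifies it with the L² limit. -/
theorem isClosed_bergmanSubmodule (hΩ : IsOpen Ω) :
    IsClosed (bergmanSubmodule Ω : Set (Lp ℂ 2 (volume.restrict Ω))) := by
  refine isClosed_of_closure_subset fun g hg => ?_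
  obtain ⟨u, hu, hlim⟩ := mem_closure_iff_seq_limit.1 hg
  choose f hf hfu using hu
  have hcauchy := hlim.cauchySeq
  have hunif : ∀ c ∈ Ω, ∃ r > 0, ball c r ⊆ Ω ∧ UniformCauchySeqOn f atTop (ball c r) := by
    intro c hc
    obtain ⟨ε, hε, hball⟩ := Metric.isOpen_iff.1 hΩ c hc
    obtain ⟨C, hC0, hC⟩ := norm_apply_le_of_closedBall_subset hΩ (r := ε / 3) (by positivity)
    refine ⟨ε / 3, by positivity, (ball_subset_ball (by linarith)).trans hball, ?_⟩
    rw [Metric.uniformCauchySeqOn_iff]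
    intro δ hδ
    obtain ⟨N, hN⟩ := Metric.cauchySeq_iff.1 hcauchy (δ / (C + 1)) (by positivity)
    refine ⟨N, fun k hk l hl z hz => ?_⟩
    have hz' : closedBall z (ε / 3) ⊆ Ω := by
      refine Subset.trans ?_ hball
      refine closedBall_subset_ball' ?_
      rw [mem_ball] at hz; linarith
    have h1 := hC z hz' (f k - f l) (u k - u l) ((hf k).sub (hf l))
      (((hfu k).sub (hfu l)).trans (Lp.coeFn_sub _ _).symm)
    have h2 := hN k hk l hl
    rw [dist_eq_norm] at h2 ⊢
    rw [lt_div_iff₀ (by positivity)] at h2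
    rw [Pi.sub_apply] at h1
    nlinarith [norm_nonneg (u k - u l)]
  have hex : ∀ z, ∃ y, z ∈ Ω → Tendsto (fun k => f k z) atTop (𝓝 y) := by
    intro z
    by_cases hz : z ∈ Ω
    · obtain ⟨r, hr, -, h⟩ := hunif z hz
      obtain ⟨y, hy⟩ := cauchySeq_tendsto_of_complete (h.cauchySeq (mem_ball_self hr))
      exact ⟨y, fun _ => hy⟩
    · exact ⟨0, fun h => absurd h hz⟩
  choose F hF using hex
  refine ⟨F, fun c hc => ?_, ?_⟩
  · obtain ⟨r, hr, hsub, h⟩ := hunif c hc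
    exact (differentiableAt_of_tendstoUniformlyOn_ball hr (fun k => (hf k).mono hsub)
      (h.tendstoUniformlyOn_of_tendsto fun z hz => hF z (hsub hz))).differentiableWithinAt
  · obtain ⟨ns, hns, hae⟩ := (tendstoInMeasure_of_tendsto_Lp hlim).exists_seq_tendsto_ae
    filter_upwards [hae, ae_all_iff.2 hfu, ae_restrict_mem hΩ.measurableSet] with z h1 h2 h3
    refine tendsto_nhds_unique ((hF z h3).comp hns.tendsto_atTop) ?_
    refine h1.congr fun k => (h2 _).symm

theorem completeSpace_bergmanSubmodule (hΩ : IsOpen Ω) : CompleteSpace (bergmanSubmodule Ω) :=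
  (isClosed_bergmanSubmodule hΩ).completeSpace_coe

/-- The holomorphic representative of an element of the Bergman space. -/
def bergmanRep (g : bergmanSubmodule Ω) : (Fin n → ℂ) → ℂ := g.2.choose

theorem bergmanRep_differentiableOn (g : bergmanSubmodule Ω) :
    DifferentiableOn ℂ (bergmanRep g) Ω := g.2.choose_spec.1

theorem bergmanRep_ae_eq (g : bergmanSubmodule Ω) :
    bergmanRep g =ᵐ[volume.restrict Ω] (g : Lp ℂ 2 (volume.restrict Ω)) := g.2.choose_spec.2

theorem bergmanRep_mem (g : bergmanSubmodule Ω) : bergmanRep g ∈ bergmanSpace Ω :=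
  mem_bergmanSpace_of_ae_eq (bergmanRep_differentiableOn g) (bergmanRep_ae_eq g)

/-- Continuous functions that agree a.e. on an open set agree on it, so values on `Ω` do not depend
on the chosen representative. -/
theorem bergmanRep_eq_of_ae_eq (hΩ : IsOpen Ω) {g : bergmanSubmodule Ω} {f : (Fin n → ℂ) → ℂ}
    (hf : DifferentiableOn ℂ f Ω)
    (hfg : f =ᵐ[volume.restrict Ω] (g : Lp ℂ 2 (volume.restrict Ω))) {z : Fin n → ℂ} (hz : z ∈ Ω) :
    bergmanRep g z = f z :=
  Measure.eqOn_open_of_ae_eq ((bergmanRep_ae_eq g).trans hfg.symm) hΩ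
    (bergmanRep_differentiableOn g).continuousOn hf.continuousOn hz

/-- Evaluation at a point as a linear functional on the Bergman space. -/
def bergmanEvalLinear (hΩ : IsOpen Ω) {z : Fin n → ℂ} (hz : z ∈ Ω) : bergmanSubmodule Ω →ₗ[ℂ] ℂ where
  toFun g := bergmanRep g z
  map_add' a b := bergmanRep_eq_of_ae_eq hΩ
    (f := bergmanRep a + bergmanRep b)
    ((bergmanRep_differentiableOn a).add (bergmanRep_differentiableOn b))
    (((bergmanRep_ae_eq a).add (bergmanRep_ae_eq b)).trans (Lp.coeFn_add _ _).symm) hz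
  map_smul' c a := bergmanRep_eq_of_ae_eq hΩ (f := c • bergmanRep a)
    ((bergmanRep_differentiableOn a).const_smul c)
    (((bergmanRep_ae_eq a).const_smul c).trans (Lp.coeFn_smul _ _).symm) hz

theorem exists_bound_bergmanEvalLinear (hΩ : IsOpen Ω) {z : Fin n → ℂ} (hz : z ∈ Ω) :
    ∃ C, ∀ g, ‖bergmanEvalLinear hΩ hz g‖ ≤ C * ‖g‖ := by
  obtain ⟨r, hr, hball⟩ := Metric.nhds_basis_closedBall.mem_iff.1 (hΩ.mem_nhds hz)
  obtain ⟨C, -, hC⟩ := norm_apply_le_of_closedBall_subset hΩ hr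
  exact ⟨C, fun g => hC z hball _ g (bergmanRep_differentiableOn g) (bergmanRep_ae_eq g)⟩

open Classical in
/-- Evaluation at `z ∈ Ω` as a continuous functional on the Bergman space. -/
def bergmanEval (hΩ : IsOpen Ω) (z : Fin n → ℂ) : StrongDual ℂ (bergmanSubmodule Ω) :=
  if hz : z ∈ Ω then
    (bergmanEvalLinear hΩ hz).mkContinuousOfExistsBound (exists_bound_bergmanEvalLinear hΩ hz)
  else 0

theorem bergmanEval_apply (hΩ : IsOpen Ω) {z : Fin n → ℂ} (hz : z ∈ Ω) (g : bergmanSubmodule Ω) :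
    bergmanEval hΩ z g = bergmanRep g z := by
  rw [bergmanEval, dif_pos hz]; rfl

theorem bergmanEval_toBergman (hΩ : IsOpen Ω) {z : Fin n → ℂ} (hz : z ∈ Ω)
    {f : (Fin n → ℂ) → ℂ} (hf : f ∈ bergmanSpace Ω) : bergmanEval hΩ z (toBergman hf) = f z := by
  rw [bergmanEval_apply hΩ hz, bergmanRep_eq_of_ae_eq hΩ hf.1 (toBergman_ae_eq hf) hz]

theorem toBergman_bergmanRep (g : bergmanSubmodule Ω) : toBergman (bergmanRep_mem g) = g :=
  Subtype.ext (Lp.ext ((toBergman_ae_eq (bergmanRep_mem g)).symm.trans (bergmanRep_ae_eq g)))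

theorem bergmanEval_differentiableOn (hΩ : IsOpen Ω) :
    DifferentiableOn ℂ (bergmanEval hΩ) Ω := by
  refine differentiableOn_strongDual_of_apply hΩ (fun g => ?_) fun c hc => ?_
  · exact (bergmanRep_differentiableOn g).congr fun z hz => bergmanEval_apply hΩ hz g
  · obtain ⟨ε, hε, hball⟩ := Metric.isOpen_iff.1 hΩ c hc
    obtain ⟨C, hC0, hC⟩ := norm_apply_le_of_closedBall_subset hΩ (r := ε / 2) (by positivity)
    refine ⟨C, eventually_of_mem (ball_mem_nhds c (half_pos hε)) fun z hz => ?_⟩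
    have hz' : closedBall z (ε / 2) ⊆ Ω := by
      refine (closedBall_subset_ball' ?_).trans hball
      rw [mem_ball] at hz; linarith
    refine ContinuousLinearMap.opNorm_le_bound _ hC0 fun g => ?_
    rw [bergmanEval_apply hΩ (hz' (mem_closedBall_self (by positivity)))]
    exact hC z hz' _ g (bergmanRep_differentiableOn g) (bergmanRep_ae_eq g)

end BergmanHilbert

/-! ### The Bergman kernel through Riesz representation. -/

section KernelVector

open Metric Filter Set InnerProductSpace
open scoped Topology InnerProductSpace ComplexConjugate

/-- The inverse of the Riesz isomorphism, as a real linear map. -/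
def rieszReal (H : Type*) [NormedAddCommGroup H] [InnerProductSpace ℂ H] [CompleteSpace H] :
    StrongDual ℂ H →L[ℝ] H :=
  ((toDual ℂ H).symm : StrongDual ℂ H →+ H).toRealLinearMap (toDual ℂ H).symm.continuous

variable {H : Type*} [NormedAddCommGroup H] [InnerProductSpace ℂ H] [CompleteSpace H]

theorem inner_rieszReal (L : StrongDual ℂ H) (x : H) : ⟪rieszReal H L, x⟫_ℂ = L x :=
  toDual_symm_apply

theorem rieszReal_smul (a : ℂ) (L : StrongDual ℂ H) :
    rieszReal H (a • L) = conj a • rieszReal H L :=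
  map_smulₛₗ (toDual ℂ H).symm a L

theorem norm_rieszReal (L : StrongDual ℂ H) : ‖rieszReal H L‖ = ‖L‖ :=
  (toDual ℂ H).symm.norm_map L

variable {n : ℕ} {Ω : Set (Fin n → ℂ)}

theorem inner_toBergman {f g : (Fin n → ℂ) → ℂ} (hf : f ∈ bergmanSpace Ω)
    (hg : g ∈ bergmanSpace Ω) :
    ⟪toBergman hg, toBergman hf⟫_ℂ = ∫ z in Ω, f z * conj (g z) := by
  rw [Submodule.coe_inner, L2.inner_def]
  refine integral_congr_ae ?_
  filter_upwards [toBergman_ae_eq hf, toBergman_ae_eq hg] with z h1 h2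
  rw [← h1, ← h2]
  rfl

variable [CompleteSpace (bergmanSubmodule Ω)]

theorem exists_isBergmanKernel (hΩ : IsOpen Ω) : ∃ k, IsBergmanKernel Ω k := by
  refine ⟨fun z w => bergmanRep (rieszReal _ (bergmanEval hΩ w)) z, fun w hw =>
    ⟨bergmanRep_mem _, fun f hf => ?_⟩⟩
  rw [← inner_toBergman hf (bergmanRep_mem _), toBergman_bergmanRep, inner_rieszReal,
    bergmanEval_toBergman hΩ hw]

theorem isBergmanKernel_bergmanKernel (hΩ : IsOpen Ω) : IsBergmanKernel Ω (bergmanKernel Ω) :=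
  Classical.epsilon_spec (exists_isBergmanKernel hΩ)

/-- The kernel is an arbitrary choice known only by its reproducing property, but that property
forces the class of `k(·, w)` to be the Riesz vector of evaluation at `w`. -/
theorem bergmanKernel_eq_inner (hΩ : IsOpen Ω) {z w : Fin n → ℂ} (hz : z ∈ Ω) (hw : w ∈ Ω) :
    bergmanKernel Ω z w =
      ⟪rieszReal _ (bergmanEval hΩ z), rieszReal _ (bergmanEval hΩ w)⟫_ℂ := by
  obtain ⟨hk, hrep⟩ := isBergmanKernel_bergmanKernel hΩ w hw
  have : toBergman hk = rieszReal _ (bergmanEval hΩ w) := by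
    refine ext_inner_right ℂ fun g => ?_
    rw [inner_rieszReal, ← toBergman_bergmanRep g, inner_toBergman (bergmanRep_mem g) hk,
      bergmanEval_toBergman hΩ hw, hrep _ (bergmanRep_mem g)]
  rw [inner_rieszReal, ← this, bergmanEval_toBergman hΩ hz]

theorem bergmanKernel_self (hΩ : IsOpen Ω) {z : Fin n → ℂ} (hz : z ∈ Ω) :
    bergmanKernel Ω z z = ((‖rieszReal _ (bergmanEval hΩ z)‖ ^ 2 : ℝ) : ℂ) := by
  rw [bergmanKernel_eq_inner hΩ hz hz]
  refine (inner_self_eq_norm_sq_to_K (𝕜 := ℂ) (E := bergmanSubmodule Ω) _).trans ?_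
  simp

end KernelVector

/-! ### The Levi form of the logarithm of a squared norm. -/

section LeviForm

open Metric Filter Set InnerProductSpace
open scoped Topology InnerProductSpace ComplexConjugate

variable {n : ℕ} {H : Type*} [NormedAddCommGroup H] [InnerProductSpace ℂ H] [CompleteSpace H]

theorem hasFDerivAt_inner_rieszReal {a b : (Fin n → ℂ) → StrongDual ℂ H}
    {a' b' : (Fin n → ℂ) →L[ℂ] StrongDual ℂ H} {p : Fin n → ℂ} (ha : HasFDerivAt a a' p)
    (hb : HasFDerivAt b b' p) :
    ∃ L : (Fin n → ℂ) →L[ℝ] ℂ,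
      HasFDerivAt (fun z => ⟪rieszReal H (a z), rieszReal H (b z)⟫_ℂ) L p ∧
      ∀ v, L v = ⟪rieszReal H (a p), rieszReal H (b' v)⟫_ℂ
        + ⟪rieszReal H (a' v), rieszReal H (b p)⟫_ℂ := by
  have h1 := (rieszReal H).hasFDerivAt.comp p (ha.restrictScalars ℝ)
  have h2 := (rieszReal H).hasFDerivAt.comp p (hb.restrictScalars ℝ)
  exact ⟨_, h1.inner ℂ h2, fun v => rfl⟩

theorem single_I_eq_smul (ν : Fin n) :
    (Pi.single ν Complex.I : Fin n → ℂ) = Complex.I • Pi.single ν 1 := by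
  rw [← Pi.single_smul]; simp

/-- The pairing of Riesz vectors is linear in the first functional and conjugate linear in the
second. Hence for holomorphic families ∂ differentiates only the first slot and ∂̄ only the second.
-/
theorem inner_rieszReal_I_smul_right (x : H) (L : StrongDual ℂ H) :
    ⟪x, rieszReal H (Complex.I • L)⟫_ℂ = -Complex.I * ⟪x, rieszReal H L⟫_ℂ := by
  rw [rieszReal_smul, inner_smul_right, Complex.conj_I]

theorem inner_rieszReal_I_smul_left (x : H) (L : StrongDual ℂ H) :
    ⟪rieszReal H (Complex.I • L), x⟫_ℂ = Complex.I * ⟪rieszReal H L, x⟫_ℂ := by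
  rw [inner_rieszReal, inner_rieszReal]; rfl

/-- The Levi form of `log ‖e‖²` for a nonvanishing holomorphic map `e` into the dual of a Hilbert
space. -/
theorem leviForm_log_norm_sq {Ω : Set (Fin n → ℂ)} (hΩ : IsOpen Ω)
    {e : (Fin n → ℂ) → StrongDual ℂ H} (he : DifferentiableOn ℂ e Ω) (h0 : ∀ z ∈ Ω, e z ≠ 0)
    {u : (Fin n → ℂ) → ℝ} (hu : ∀ z ∈ Ω, u z = Real.log (‖rieszReal H (e z)‖ ^ 2))
    {p : Fin n → ℂ} (hp : p ∈ Ω) (ξ : Fin n → ℂ) :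
    leviForm u p ξ = (‖rieszReal H (e p)‖ ^ 2 * ‖rieszReal H (fderiv ℂ e p ξ)‖ ^ 2
      - ‖⟪rieszReal H (e p), rieszReal H (fderiv ℂ e p ξ)⟫_ℂ‖ ^ 2)
        / (‖rieszReal H (e p)‖ ^ 2) ^ 2 := by
  set N : (Fin n → ℂ) → ℂ := fun z => ⟪rieszReal H (e z), rieszReal H (e z)⟫_ℂ with hN
  have hNeq : ∀ z, N z = ((‖rieszReal H (e z)‖ ^ 2 : ℝ) : ℂ) := fun z => by
    simp only [hN]
    rw [inner_self_eq_norm_sq_to_K]; simp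
  have hpos : ∀ z ∈ Ω, 0 < ‖rieszReal H (e z)‖ ^ 2 := fun z hz => by
    rw [norm_rieszReal]
    have := norm_pos_iff.2 (h0 z hz)
    positivity
  have hN0 : ∀ z ∈ Ω, N z ≠ 0 := fun z hz => by
    rw [hNeq]; exact_mod_cast (hpos z hz).ne'
  have hed : ∀ z ∈ Ω, HasFDerivAt e (fderiv ℂ e z) z := fun z hz =>
    (he.differentiableAt (hΩ.mem_nhds hz)).hasFDerivAt
  have hbar : ∀ μ, ∀ z ∈ Ω, wirtingerBar μ (fun z => (u z : ℂ)) z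
      = ⟪rieszReal H (e z), rieszReal H (fderiv ℂ e z (Pi.single μ 1))⟫_ℂ / N z := by
    intro μ z hz
    obtain ⟨L, hL, hLv⟩ := hasFDerivAt_inner_rieszReal (hed z hz) (hed z hz)
    have hlog : HasFDerivAt (fun z => (u z : ℂ)) ((N z)⁻¹ • L) z := by
      have hslit : N z ∈ Complex.slitPlane := by
        rw [hNeq]; exact Complex.ofReal_mem_slitPlane.2 (hpos z hz)
      have h1 := ((Complex.hasStrictDerivAt_log hslit).hasDerivAt.complexToReal_fderiv).comp z hL
      have h2 : (fun z => (u z : ℂ)) =ᶠ[𝓝 z] Complex.log ∘ N := by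
        filter_upwards [hΩ.mem_nhds hz] with w hw
        rw [hu w hw, Function.comp_apply, hNeq, Complex.ofReal_log (hpos w hw).le]
      refine (h1.congr_of_eventuallyEq h2).congr_fderiv ?_
      ext v; simp
    rw [wirtingerBar, hlog.fderiv, single_I_eq_smul]
    simp only [smul_apply, smul_eq_mul, hLv, map_smul,
      inner_rieszReal_I_smul_right, inner_rieszReal_I_smul_left]
    have := hN0 z hz
    field_simp
    ring_nf
    rw [Complex.I_sq]; ring
  have hmixed : ∀ ν μ, wirtinger ν (wirtingerBar μ (fun z => (u z : ℂ))) p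
      = ⟪rieszReal H (fderiv ℂ e p (Pi.single ν 1)),
          rieszReal H (fderiv ℂ e p (Pi.single μ 1))⟫_ℂ / N p
        - ⟪rieszReal H (fderiv ℂ e p (Pi.single ν 1)), rieszReal H (e p)⟫_ℂ
          * ⟪rieszReal H (e p), rieszReal H (fderiv ℂ e p (Pi.single μ 1))⟫_ℂ / N p ^ 2 := by
    intro ν μ
    have hμ := ((he.fderiv_apply_of_complex hΩ (Pi.single μ 1)).differentiableAt
      (hΩ.mem_nhds hp)).hasFDerivAt
    obtain ⟨L, hL, hLv⟩ := hasFDerivAt_inner_rieszReal (hed p hp) (hed p hp)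
    obtain ⟨A, hA, hAv⟩ := hasFDerivAt_inner_rieszReal (hed p hp) hμ
    have hinv : HasFDerivAt (fun z => (N z)⁻¹) (-(N p ^ 2)⁻¹ • L) p := by
      have h1 := ((hasDerivAt_inv (hN0 p hp)).complexToReal_fderiv).comp p hL
      refine h1.congr_fderiv ?_
      ext v; simp
    have hq := hA.mul hinv
    have heq : wirtingerBar μ (fun z => (u z : ℂ)) =ᶠ[𝓝 p] fun z =>
        ⟪rieszReal H (e z), rieszReal H (fderiv ℂ e z (Pi.single μ 1))⟫_ℂ * (N z)⁻¹ := by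
      filter_upwards [hΩ.mem_nhds hp] with z hz
      rw [hbar μ z hz, div_eq_mul_inv]
    rw [wirtinger, (hq.congr_of_eventuallyEq heq).fderiv, single_I_eq_smul]
    simp only [smul_apply, add_apply, smul_eq_mul, hLv, hAv, map_smul,
      inner_rieszReal_I_smul_right, inner_rieszReal_I_smul_left]
    have := hN0 p hp
    field_simp
    ring_nf
    rw [Complex.I_sq]; ring
  -- Summing against ξ reassembles the coordinate derivatives into the derivative in direction ξ.
  have hleft : ∀ x : H, ∑ ν, ⟪rieszReal H (fderiv ℂ e p (Pi.single ν 1)), x⟫_ℂ * ξ ν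
      = ⟪rieszReal H (fderiv ℂ e p ξ), x⟫_ℂ := by
    intro x
    have hξ : ξ = ∑ ν, ξ ν • (Pi.single ν 1 : Fin n → ℂ) := by
      ext i; simp [Finset.sum_apply, Pi.single_apply]
    conv_rhs => rw [hξ]
    rw [inner_rieszReal, map_sum, sum_apply]
    refine Finset.sum_congr rfl fun ν _ => ?_
    rw [inner_rieszReal, map_smul, smul_apply, smul_eq_mul, mul_comm]
  have hright : ∀ x : H, ∑ μ, ⟪x, rieszReal H (fderiv ℂ e p (Pi.single μ 1))⟫_ℂ * conj (ξ μ)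
      = ⟪x, rieszReal H (fderiv ℂ e p ξ)⟫_ℂ := by
    intro x
    rw [← inner_conj_symm, ← hleft, map_sum]
    refine Finset.sum_congr rfl fun μ _ => ?_
    rw [map_mul, inner_conj_symm]
  have hsum : ∑ ν, ∑ μ, wirtinger ν (wirtingerBar μ (fun z => (u z : ℂ))) p * ξ ν * conj (ξ μ)
      = ⟪rieszReal H (fderiv ℂ e p ξ), rieszReal H (fderiv ℂ e p ξ)⟫_ℂ / N p
        - ⟪rieszReal H (fderiv ℂ e p ξ), rieszReal H (e p)⟫_ℂ
          * ⟪rieszReal H (e p), rieszReal H (fderiv ℂ e p ξ)⟫_ℂ / N p ^ 2 := by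
    have h1 : ∀ ν, ∑ μ, wirtinger ν (wirtingerBar μ (fun z => (u z : ℂ))) p * ξ ν * conj (ξ μ)
        = (⟪rieszReal H (fderiv ℂ e p (Pi.single ν 1)), rieszReal H (fderiv ℂ e p ξ)⟫_ℂ * ξ ν)
            / N p
          - (⟪rieszReal H (fderiv ℂ e p (Pi.single ν 1)), rieszReal H (e p)⟫_ℂ * ξ ν)
            * ⟪rieszReal H (e p), rieszReal H (fderiv ℂ e p ξ)⟫_ℂ / N p ^ 2 := by
      intro ν
      rw [← hright, ← hright, Finset.sum_mul, Finset.mul_sum, Finset.sum_div, Finset.sum_div,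
        ← Finset.sum_sub_distrib]
      refine Finset.sum_congr rfl fun μ _ => ?_
      rw [hmixed]; ring
    simp_rw [h1]
    rw [Finset.sum_sub_distrib, ← Finset.sum_div, ← Finset.sum_div, ← Finset.sum_mul, hleft, hleft]
  have hself : ⟪rieszReal H (fderiv ℂ e p ξ), rieszReal H (fderiv ℂ e p ξ)⟫_ℂ
      = ((‖rieszReal H (fderiv ℂ e p ξ)‖ ^ 2 : ℝ) : ℂ) := by
    rw [inner_self_eq_norm_sq_to_K]; simp
  have hcross : ⟪rieszReal H (fderiv ℂ e p ξ), rieszReal H (e p)⟫_ℂ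
      * ⟪rieszReal H (e p), rieszReal H (fderiv ℂ e p ξ)⟫_ℂ
      = ((‖⟪rieszReal H (e p), rieszReal H (fderiv ℂ e p ξ)⟫_ℂ‖ ^ 2 : ℝ) : ℂ) := by
    rw [← inner_conj_symm, Complex.conj_mul']; simp
  rw [leviForm, hsum, hself, hcross, hNeq]
  norm_cast
  have := (hpos p hp).ne'
  field_simp

end LeviForm

/-! ### The Bergman metric of a bounded open set. -/

section BergmanMetric

open Metric Filter Set InnerProductSpace
open scoped Topology InnerProductSpace ComplexConjugate

variable {n : ℕ} {Ω : Set (Fin n → ℂ)}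

/-- Boundedness puts the constant 1 in the Bergman space. -/
theorem bergmanEval_ne_zero (hΩ : IsOpen Ω) (hb : Bornology.IsBounded Ω) {z : Fin n → ℂ}
    (hz : z ∈ Ω) : bergmanEval hΩ z ≠ 0 := by
  have : IsFiniteMeasure (volume.restrict Ω) := ⟨by simpa using hb.measure_lt_top⟩
  have h1 : (fun _ => 1 : (Fin n → ℂ) → ℂ) ∈ bergmanSpace Ω :=
    ⟨differentiableOn_const 1, memLp_const 1⟩
  intro h
  have := bergmanEval_toBergman hΩ hz h1
  rw [h] at this
  simp at this

variable [CompleteSpace (bergmanSubmodule Ω)]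

theorem logBergman_eq (hΩ : IsOpen Ω) {z : Fin n → ℂ} (hz : z ∈ Ω) :
    logBergman Ω z = Real.log (‖rieszReal _ (bergmanEval hΩ z)‖ ^ 2) := by
  rw [logBergman, bergmanKernel_self hΩ hz, Complex.ofReal_re]

theorem leviForm_logBergman (hΩ : IsOpen Ω) (hb : Bornology.IsBounded Ω) {p : Fin n → ℂ}
    (hp : p ∈ Ω) (ξ : Fin n → ℂ) :
    leviForm (logBergman Ω) p ξ = (‖rieszReal _ (bergmanEval hΩ p)‖ ^ 2
        * ‖rieszReal _ (fderiv ℂ (bergmanEval hΩ) p ξ)‖ ^ 2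
      - ‖⟪rieszReal _ (bergmanEval hΩ p), rieszReal _ (fderiv ℂ (bergmanEval hΩ) p ξ)⟫_ℂ‖ ^ 2)
        / (‖rieszReal _ (bergmanEval hΩ p)‖ ^ 2) ^ 2 :=
  leviForm_log_norm_sq hΩ (bergmanEval_differentiableOn hΩ)
    (fun _ hz => bergmanEval_ne_zero hΩ hb hz) (fun _ hz => logBergman_eq hΩ hz) hp ξ

/-- Positivity comes from nonvanishing evaluation, smoothness from its holomorphy, and the sign of
the Levi form from Cauchy–Schwarz. -/
theorem hasBergmanMetric_of_isBounded (hΩ : IsOpen Ω) (hb : Bornology.IsBounded Ω) :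
    HasBergmanMetric Ω := by
  have hpos : ∀ z ∈ Ω, 0 < ‖rieszReal _ (bergmanEval hΩ z)‖ ^ 2 := fun z hz => by
    rw [norm_rieszReal]
    have := (norm_pos_iff (a := bergmanEval hΩ z)).2 (bergmanEval_ne_zero hΩ hb hz)
    positivity
  refine ⟨isBergmanKernel_bergmanKernel hΩ, fun z hz => ?_, ?_, fun z hz ξ => ?_⟩
  · rw [bergmanKernel_self hΩ hz]
    exact ⟨Complex.ofReal_im _, by rw [Complex.ofReal_re]; exact hpos z hz⟩
  · have h1 : ContDiffOn ℝ 2 (bergmanEval hΩ) Ω :=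
      ((bergmanEval_differentiableOn hΩ).contDiffOn_of_complex hΩ 2).restrict_scalars ℝ
    have h2 : ContDiffOn ℝ 2 (fun z => rieszReal _ (bergmanEval hΩ z)) Ω :=
      (rieszReal _).contDiff.comp_contDiffOn h1
    exact ((h2.norm_sq ℂ).log fun z hz => (hpos z hz).ne').congr fun z hz => logBergman_eq hΩ hz
  · rw [leviForm_logBergman hΩ hb hz]
    refine div_nonneg (sub_nonneg.2 ?_) (by positivity)
    rw [← mul_pow]
    gcongr
    exact norm_inner_le_norm (𝕜 := ℂ) (E := bergmanSubmodule Ω) _ _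

end BergmanMetric

/-! ### The Cauchy–Pompeiu formula and the ∂̄-equation with compact support. -/

section CauchyPompeiu

open Metric Filter Set
open scoped Topology ComplexConjugate

variable {E : Type*} [NormedAddCommGroup E] [NormedSpace ℂ E]

/-- The `∂̄`-derivative of `f` in the direction `v`. -/
def dbar (v : E) (f : E → ℂ) (z : E) : ℂ :=
  (fderiv ℝ f z v + Complex.I * fderiv ℝ f z (Complex.I • v)) / 2

theorem ContinuousLinearMap.apply_complex_smul (L : E →L[ℝ] ℂ) (w : ℂ) (v : E) :
    L (w • v) = w.re * L v + w.im * L (Complex.I • v) := by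
  have h : w • v = w.re • v + w.im • (Complex.I • v) := by
    conv_lhs => rw [← Complex.re_add_im w]
    rw [add_smul, mul_smul]; rfl
  rw [h, map_add, map_smul, map_smul, Complex.real_smul, Complex.real_smul]

theorem dbar_smul (w : ℂ) (v : E) (f : E → ℂ) (z : E) :
    dbar (w • v) f z = conj w * dbar v f z := by
  have h1 := (fderiv ℝ f z).apply_complex_smul w v
  have h2 := (fderiv ℝ f z).apply_complex_smul (Complex.I * w) v
  have h3 : conj w = w.re - w.im * Complex.I := by
    apply Complex.ext <;> simp
  rw [mul_smul] at h2
  rw [dbar, dbar, h1, h2, h3]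
  simp only [Complex.mul_re, Complex.mul_im, Complex.I_re, Complex.I_im, zero_mul, one_mul,
    zero_sub, zero_add, Complex.ofReal_neg]
  linear_combination ((w.im : ℂ) * fderiv ℝ f z (Complex.I • v) / 2) * Complex.I_sq

theorem dbar_congr {v : E} {f g : E → ℂ} {z : E} (h : f =ᶠ[𝓝 z] g) : dbar v f z = dbar v g z := by
  rw [dbar, dbar, h.fderiv_eq]

theorem dbar_eq_zero_of_eventuallyEq_zero {v : E} {f : E → ℂ} {z : E} (h : f =ᶠ[𝓝 z] 0) :
    dbar v f z = 0 := by
  rw [dbar_congr h, dbar]; simp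

/-- The Cauchy–Pompeiu formula for compactly supported functions. -/
theorem integral_inv_mul_dbar {g : ℂ → ℂ} (hg : ContDiff ℝ 1 g) (hc : HasCompactSupport g) :
    ∫ ζ, ζ⁻¹ * dbar 1 g ζ = -(Real.pi * g 0) := by
  let e : ℝ → ℂ := fun θ => Complex.exp (θ * Complex.I)
  have hec : Continuous e := by fun_prop
  have hen : ∀ θ, ‖e θ‖ = 1 := fun θ => Complex.norm_exp_ofReal_mul_I θ
  have hecs : ∀ θ, ((Real.cos θ : ℝ) : ℂ) + (Real.sin θ : ℝ) * Complex.I = e θ := fun θ => by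
    simp only [e]; rw [Complex.exp_mul_I, Complex.ofReal_cos, Complex.ofReal_sin]
  have hinv : ∀ θ, (e θ)⁻¹ = conj (e θ) := fun θ => by
    rw [Complex.inv_def, Complex.normSq_eq_norm_sq, hen]; simp
  have hDc : Continuous (fderiv ℝ g) := hg.continuous_fderiv one_ne_zero
  obtain ⟨R, hR0, hR⟩ : ∃ R > 0, ∀ ζ : ℂ, R < ‖ζ‖ → fderiv ℝ g ζ = 0 := by
    obtain ⟨R, hR0, hR⟩ := ((hc.fderiv ℝ).isCompact.isBounded).exists_pos_norm_le
    refine ⟨R, hR0, fun ζ hζ => ?_⟩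
    by_contra h
    exact absurd (hR ζ (subset_tsupport _ h)) (not_le.2 hζ)
  have hgd : Differentiable ℝ g := hg.differentiable one_ne_zero
  -- In polar coordinates `A` is the radial derivative of `g` and `r * B` the angular one. The
  -- Jacobian r cancels |ζ|⁻¹, leaving (A + iB)/2. Along each ray `A` integrates to -g(0); on each
  -- circle `B` integrates to 0 by periodicity.
  let A : ℝ × ℝ → ℂ := fun p => fderiv ℝ g (p.1 * e p.2) (e p.2)
  let B : ℝ × ℝ → ℂ := fun p => fderiv ℝ g (p.1 * e p.2) (Complex.I * e p.2)
  have hpe : Continuous fun p : ℝ × ℝ => (p.1 : ℂ) * e p.2 := by fun_prop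
  have hAc : Continuous A := (hDc.comp hpe).clm_apply (hec.comp continuous_snd)
  have hBc : Continuous B :=
    (hDc.comp hpe).clm_apply (continuous_const.mul (hec.comp continuous_snd))
  have hvanish : ∀ p : ℝ × ℝ, R < p.1 → fderiv ℝ g (p.1 * e p.2) = 0 := fun p hp => by
    apply hR
    rw [norm_mul, hen, mul_one, Complex.norm_real, Real.norm_of_nonneg (hR0.le.trans hp.le)]
    exact hp
  have hint : ∀ F : ℝ × ℝ → ℂ, Continuous F → (∀ p, R < p.1 → F p = 0) →
      IntegrableOn F (Ioi 0 ×ˢ Ioo (-Real.pi) Real.pi) := by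
    intro F hF h0
    have h1 : IntegrableOn F (Icc 0 R ×ˢ Icc (-Real.pi) Real.pi) :=
      hF.continuousOn.integrableOn_compact (isCompact_Icc.prod isCompact_Icc)
    refine h1.of_forall_sdiff_eq_zero (measurableSet_Ioi.prod measurableSet_Ioo) ?_
    rintro p ⟨⟨hp1, hp2⟩, hp3⟩
    refine h0 p (lt_of_not_ge fun h => hp3 ⟨⟨le_of_lt hp1, h⟩, Ioo_subset_Icc_self hp2⟩)
  have hAi := hint A hAc fun p hp => by simp only [A, hvanish p hp, zero_apply]
  have hBi := hint B hBc fun p hp => by simp only [B, hvanish p hp, zero_apply]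
  have hAint : ∫ p in Ioi (0 : ℝ) ×ˢ Ioo (-Real.pi) Real.pi, A p = -(2 * Real.pi * g 0) := by
    rw [Measure.volume_eq_prod, ← setIntegral_prod_swap, setIntegral_prod]
    · have hr : ∀ θ, ∫ r in Ioi (0 : ℝ), A (r, θ) = -g 0 := by
        intro θ
        have hd : ∀ r : ℝ, HasDerivAt (fun r : ℝ => g (r * e θ)) (A (r, θ)) r := by
          intro r
          have h1 : HasDerivAt (fun r : ℝ => (r : ℂ) * e θ) (e θ) r := by
            simpa using (Complex.ofRealCLM.hasDerivAt (x := r)).mul_const (e θ)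
          exact (hgd _).hasFDerivAt.comp_hasDerivAt r h1
        have h1 : ContDiff ℝ 1 fun r : ℝ => g (r * e θ) :=
          hg.comp (Complex.ofRealCLM.contDiff.mul contDiff_const)
        have h2 : HasCompactSupport fun r : ℝ => g (r * e θ) := by
          obtain ⟨S, hS⟩ := hc.isCompact.isBounded.exists_norm_le
          refine HasCompactSupport.intro (isCompact_closedBall (0 : ℝ) S) fun r hr => ?_
          by_contra h
          apply hr
          have := hS _ (subset_tsupport _ h)
          rw [norm_mul, hen, mul_one, Complex.norm_real] at this
          rwa [mem_closedBall_zero_iff]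
        have h3 := h2.integral_Ioi_deriv_eq h1 0
        rw [funext fun r => (hd r).deriv] at h3
        simpa using h3
      simp only [Prod.swap_prod_mk]
      simp_rw [hr]
      rw [setIntegral_const, Complex.real_smul]
      simp only [measureReal_def, Real.volume_Ioo]
      rw [ENNReal.toReal_ofReal (by linarith [Real.pi_pos])]
      push_cast; ring
    · exact hAi.swap
  have hBint : ∫ p in Ioi (0 : ℝ) ×ˢ Ioo (-Real.pi) Real.pi, B p = 0 := by
    rw [Measure.volume_eq_prod, setIntegral_prod _ hBi]
    refine (setIntegral_congr_fun (g := fun _ => (0 : ℂ)) measurableSet_Ioi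
      fun r (hr : 0 < r) => ?_).trans (by simp)
    have hd : ∀ θ : ℝ, HasDerivAt (fun θ : ℝ => g (r * e θ)) (r * B (r, θ)) θ := by
      intro θ
      have h0 : HasDerivAt e (Complex.I * e θ) θ := by
        have := ((Complex.ofRealCLM.hasDerivAt (x := θ)).mul_const Complex.I).cexp
        simpa [e, mul_comm] using this
      have h1 : HasDerivAt (fun θ : ℝ => (r : ℂ) * e θ) (r * (Complex.I * e θ)) θ :=
        h0.const_mul _
      have h2 := (hgd _).hasFDerivAt.comp_hasDerivAt θ h1
      refine h2.congr_deriv ?_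
      change fderiv ℝ g (r * e θ) (r * (Complex.I * e θ)) =
        r * fderiv ℝ g (r * e θ) (Complex.I * e θ)
      rw [← Complex.real_smul (z := Complex.I * e θ), map_smul, Complex.real_smul]
    have hz := intervalIntegral.integral_eq_sub_of_hasDerivAt (a := -Real.pi) (b := Real.pi)
      (fun θ _ => hd θ) ((continuous_const.mul (hBc.comp (by fun_prop))).intervalIntegrable _ _)
    have hper : e Real.pi = e (-Real.pi) := by
      simp only [e]; rw [Complex.exp_pi_mul_I]
      push_cast; rw [neg_mul, Complex.exp_neg, Complex.exp_pi_mul_I]; norm_num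
    rw [hper, sub_self, intervalIntegral.integral_const_mul] at hz
    have hr0 : (r : ℂ) ≠ 0 := by exact_mod_cast hr.ne'
    have hz' := (mul_eq_zero.1 hz).resolve_left hr0
    rw [intervalIntegral.integral_of_le (by linarith [Real.pi_pos]),
      integral_Ioc_eq_integral_Ioo] at hz'
    exact hz'
  rw [← Complex.integral_comp_polarCoord_symm, polarCoord_target]
  have hcongr : ∀ p ∈ Ioi (0 : ℝ) ×ˢ Ioo (-Real.pi) Real.pi,
      p.1 • ((Complex.polarCoord.symm p)⁻¹ * dbar 1 g (Complex.polarCoord.symm p))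
        = (1 / 2) * A p + (Complex.I / 2) * B p := by
    rintro p ⟨hp, -⟩
    have hp0 : (p.1 : ℂ) ≠ 0 := by exact_mod_cast (ne_of_gt hp)
    have h1 := dbar_smul (e p.2) (1 : ℂ) g (p.1 * e p.2)
    rw [Complex.polarCoord_symm_apply, hecs, Complex.real_smul, mul_inv, ← mul_assoc, ← mul_assoc,
      mul_inv_cancel₀ hp0, one_mul, hinv, ← h1, smul_eq_mul, mul_one, dbar]
    simp only [A, B, smul_eq_mul]
    ring
  rw [setIntegral_congr_fun (measurableSet_Ioi.prod measurableSet_Ioo) hcongr,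
    integral_add (hAi.const_mul _) (hBi.const_mul _), integral_const_mul, integral_const_mul,
    hAint, hBint]
  ring

/-- `ζ ↦ |ζ|⁻¹` is integrable on discs of the complex plane. -/
theorem integrableOn_norm_inv_closedBall (R : ℝ) :
    IntegrableOn (fun ζ : ℂ => ‖ζ‖⁻¹) (closedBall 0 R) := by
  rw [← integrable_indicator_iff isClosed_closedBall.measurableSet]
  have h : (closedBall (0 : ℂ) R).indicator (fun ζ : ℂ => ‖ζ‖⁻¹)
      = fun ζ : ℂ => (Iic R).indicator (fun y : ℝ => y⁻¹) ‖ζ‖ := by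
    ext ζ
    simp [indicator]
  rw [h, integrable_fun_norm_addHaar volume, Complex.finrank_real_complex]
  have h2 : IntegrableOn (fun _ : ℝ => (1 : ℝ)) (Ioc 0 R) := by simp
  refine IntegrableOn.congr_fun (f := (Ioc 0 R).indicator fun _ => (1 : ℝ)) ?_ ?_ measurableSet_Ioi
  · exact ((integrable_indicator_iff measurableSet_Ioc).2 h2).integrableOn
  · intro y hy
    have hy0 : y ≠ 0 := ne_of_gt hy
    by_cases hyR : y ≤ R
    · simp [indicator, hyR, mem_Ioi.1 hy, hy0]
    · simp [indicator, hyR]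

variable {F : Type*} [NormedAddCommGroup F] [NormedSpace ℂ F]

/-- Integrability of the Cauchy kernel against a continuous compactly supported function. -/
theorem exists_bound_inv_smul_comp {φ : E → F} (hφ : Continuous φ) (hc : HasCompactSupport φ)
    {e : E} (he : ‖e‖ = 1) (z : E) : ∃ b : ℂ → ℝ, Integrable b ∧
      ∀ ζ, ∀ x ∈ ball z 1, ‖ζ⁻¹ • φ (x - ζ • e)‖ ≤ b ζ := by
  obtain ⟨C, hC⟩ := hc.exists_bound_of_continuous hφ
  obtain ⟨ρ, hρ⟩ := hc.isCompact.isBounded.exists_norm_le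
  -- For |ζ| beyond this radius, `x - ζ • e` leaves the support for every `x` in the unit ball about
  -- `z`, so one bound serves for differentiation under the integral.
  refine ⟨(closedBall (0 : ℂ) (ρ + ‖z‖ + 1)).indicator fun ζ => C * ‖ζ‖⁻¹,
    (integrable_indicator_iff isClosed_closedBall.measurableSet).2
      ((integrableOn_norm_inv_closedBall _).const_mul C), fun ζ x hx => ?_⟩
  by_cases hζ : ζ ∈ closedBall (0 : ℂ) (ρ + ‖z‖ + 1)
  · rw [indicator_of_mem hζ, norm_smul, norm_inv, mul_comm]
    gcongr
    exact hC _
  · rw [indicator_of_notMem hζ]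
    have : φ (x - ζ • e) = 0 := by
      by_contra h
      apply hζ
      have h1 := hρ _ (subset_tsupport _ h)
      rw [mem_closedBall_zero_iff]
      rw [mem_ball, dist_eq_norm] at hx
      have h2 : ‖ζ‖ = ‖ζ • e‖ := by rw [norm_smul, he, mul_one]
      have h3 : ζ • e = (x - z) + z - (x - ζ • e) := by abel
      rw [h2, h3]
      have := norm_sub_le ((x - z) + z) (x - ζ • e)
      have := norm_add_le (x - z) z
      linarith
    rw [this, smul_zero, norm_zero]

theorem aestronglyMeasurable_inv_smul_comp {φ : E → F} (hφ : Continuous φ) (e z : E) :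
    AEStronglyMeasurable (fun ζ : ℂ => ζ⁻¹ • φ (z - ζ • e)) volume :=
  (measurable_inv.aestronglyMeasurable).smul
    (hφ.comp (by fun_prop : Continuous fun ζ : ℂ => z - ζ • e)).aestronglyMeasurable

/-- The Cauchy transform of `φ` along the complex line spanned by `e`. -/
def cauchyTransform (e : E) (φ : E → ℂ) (z : E) : ℂ := ∫ ζ : ℂ, ζ⁻¹ * φ (z - ζ • e)

theorem hasFDerivAt_cauchyTransform {φ : E → ℂ} (hφ : ContDiff ℝ 1 φ) (hc : HasCompactSupport φ)
    {e : E} (he : ‖e‖ = 1) (z : E) :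
    Integrable (fun ζ : ℂ => ζ⁻¹ • fderiv ℝ φ (z - ζ • e)) ∧
    HasFDerivAt (cauchyTransform e φ) (∫ ζ : ℂ, ζ⁻¹ • fderiv ℝ φ (z - ζ • e)) z := by
  have hDc : Continuous (fderiv ℝ φ) := hφ.continuous_fderiv one_ne_zero
  obtain ⟨b, hb, hbb⟩ := exists_bound_inv_smul_comp hφ.continuous hc he z
  obtain ⟨b', hb', hbb'⟩ := exists_bound_inv_smul_comp hDc (hc.fderiv ℝ) he z
  refine ⟨hb'.mono' (aestronglyMeasurable_inv_smul_comp hDc e z)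
    (Eventually.of_forall fun ζ => hbb' ζ z (mem_ball_self one_pos)), ?_⟩
  refine hasFDerivAt_integral_of_dominated_of_fderiv_le (𝕜 := ℝ)
    (F := fun x ζ => ζ⁻¹ * φ (x - ζ • e))
    (F' := fun x ζ => ζ⁻¹ • fderiv ℝ φ (x - ζ • e)) (ball_mem_nhds z one_pos)
    (Eventually.of_forall fun x => aestronglyMeasurable_inv_smul_comp hφ.continuous e x)
    (hb.mono' (aestronglyMeasurable_inv_smul_comp hφ.continuous e z)
      (Eventually.of_forall fun ζ => hbb ζ z (mem_ball_self one_pos)))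
    (aestronglyMeasurable_inv_smul_comp hDc e z)
    (Eventually.of_forall hbb') hb' (Eventually.of_forall fun ζ x _ => ?_)
  have h1 : HasFDerivAt (fun x => φ (x - ζ • e)) (fderiv ℝ φ (x - ζ • e)) x :=
    (hasFDerivAt_comp_sub (ζ • e)).2 ((hφ.differentiable one_ne_zero) (x - ζ • e)).hasFDerivAt
  exact h1.const_mul ζ⁻¹

theorem dbar_cauchyTransform_apply {φ : E → ℂ} (hφ : ContDiff ℝ 1 φ) (hc : HasCompactSupport φ)
    {e : E} (he : ‖e‖ = 1) (v z : E) :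
    dbar v (cauchyTransform e φ) z = ∫ ζ : ℂ, ζ⁻¹ * dbar v φ (z - ζ • e) := by
  obtain ⟨hint, hd⟩ := hasFDerivAt_cauchyTransform hφ hc he z
  have hap : ∀ w, Integrable fun ζ : ℂ => (ζ⁻¹ • fderiv ℝ φ (z - ζ • e)) w := fun w =>
    (ContinuousLinearMap.apply ℝ ℂ w).integrable_comp hint
  rw [dbar, hd.fderiv, ContinuousLinearMap.integral_apply hint,
    ContinuousLinearMap.integral_apply hint, ← integral_const_mul,
    ← integral_add (hap _) ((hap _).const_mul _), ← integral_div]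
  refine integral_congr_ae (Eventually.of_forall fun ζ => ?_)
  simp only [dbar, smul_apply, smul_eq_mul]
  ring

/-- The Cauchy transform inverts `∂̄` in the direction `e`. -/
theorem integral_inv_mul_dbar_comp {φ : E → ℂ} (hφ : ContDiff ℝ 1 φ) (hc : HasCompactSupport φ)
    {e : E} (he : ‖e‖ = 1) (z : E) :
    ∫ ζ : ℂ, ζ⁻¹ * dbar e φ (z - ζ • e) = Real.pi * φ z := by
  have hℓ : ∀ ζ : ℂ, HasFDerivAt (fun ζ : ℂ => z - ζ • e)
      (-(ContinuousLinearMap.toSpanSingleton ℂ e).restrictScalars ℝ) ζ := fun ζ => by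
    exact (((ContinuousLinearMap.toSpanSingleton ℂ e).restrictScalars ℝ).hasFDerivAt).const_sub z
  have hg : ContDiff ℝ 1 fun ζ : ℂ => φ (z - ζ • e) :=
    hφ.comp (contDiff_const.sub (contDiff_id.smul contDiff_const))
  have hgc : HasCompactSupport fun ζ : ℂ => φ (z - ζ • e) := by
    obtain ⟨ρ, hρ⟩ := hc.isCompact.isBounded.exists_norm_le
    refine HasCompactSupport.intro (isCompact_closedBall (0 : ℂ) (‖z‖ + ρ)) fun ζ hζ => ?_
    by_contra h
    apply hζ
    have h1 := hρ _ (subset_tsupport _ h)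
    have h2 : ‖ζ‖ = ‖z - (z - ζ • e)‖ := by rw [sub_sub_cancel, norm_smul, he, mul_one]
    rw [mem_closedBall_zero_iff, h2]
    exact (norm_sub_le _ _).trans (by linarith)
  have hd : ∀ ζ : ℂ, dbar 1 (fun ζ : ℂ => φ (z - ζ • e)) ζ = -dbar e φ (z - ζ • e) := by
    intro ζ
    have h1 : HasFDerivAt (fun ζ : ℂ => φ (z - ζ • e)) _ ζ :=
      ((hφ.differentiable one_ne_zero) (z - ζ • e)).hasFDerivAt.comp ζ (hℓ ζ)
    rw [dbar, h1.fderiv, dbar]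
    simp
    ring
  have key := integral_inv_mul_dbar hg hgc
  simp_rw [hd, mul_neg] at key
  rw [integral_neg, neg_inj] at key
  simpa using key

/-- Solution of the `∂̄`-equation with compactly supported data. -/
theorem dbar_cauchyTransform {φ ψ : E → ℂ} (hφ : ContDiff ℝ 1 φ) (hc : HasCompactSupport φ)
    (hψ : ContDiff ℝ 1 ψ) (hψc : HasCompactSupport ψ) {e v : E} (he : ‖e‖ = 1)
    (hcompat : ∀ z, dbar v φ z = dbar e ψ z) (z : E) :
    dbar v (cauchyTransform e φ) z = Real.pi * ψ z := by
  -- Under the integral, compatibility trades ∂̄ of `φ` along `v` for ∂̄ of `ψ` along `e`, which the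
  -- Cauchy transform inverts.
  rw [dbar_cauchyTransform_apply hφ hc he, ← integral_inv_mul_dbar_comp hψ hψc he]
  simp_rw [hcompat]

end CauchyPompeiu

/-! ### Hartogs' extension theorem by solving a ∂̄-equation. -/

section Hartogs

open Metric Filter Set
open scoped Topology ContDiff

section dbar

variable {E : Type*} [NormedAddCommGroup E] [NormedSpace ℂ E]

/-- A real differentiable function killed by all `∂̄`-derivatives is complex differentiable. -/
theorem differentiableAt_complex_of_dbar_eq_zero {f : E → ℂ} {z : E}
    (hf : DifferentiableAt ℝ f z) (h : ∀ v, dbar v f z = 0) : DifferentiableAt ℂ f z := by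
  have hI : ∀ v, fderiv ℝ f z (Complex.I • v) = Complex.I * fderiv ℝ f z v := by
    intro v
    have := h v
    rw [dbar, div_eq_zero_iff] at this
    have := this.resolve_right two_ne_zero
    linear_combination (-Complex.I) * this + fderiv ℝ f z (Complex.I • v) * Complex.I_sq
  let L : E →L[ℂ] ℂ :=
    { toFun := fderiv ℝ f z
      map_add' := map_add _
      map_smul' := fun w v => by
        rw [(fderiv ℝ f z).apply_complex_smul, hI, RingHom.id_apply, smul_eq_mul]
        conv_rhs => rw [← Complex.re_add_im w]
        ring
      cont := (fderiv ℝ f z).continuous }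
  exact (differentiableAt_iff_restrictScalars ℝ hf).2 ⟨L, by ext v; rfl⟩

theorem dbar_add {v : E} {f g : E → ℂ} {z : E} (hf : DifferentiableAt ℝ f z)
    (hg : DifferentiableAt ℝ g z) :
    dbar v (fun x => f x + g x) z = dbar v f z + dbar v g z := by
  simp only [dbar]
  rw [fderiv_fun_add hf hg]
  simp only [add_apply]
  ring

theorem dbar_const_mul {v : E} {f : E → ℂ} {z : E} (c : ℂ) (hf : DifferentiableAt ℝ f z) :
    dbar v (fun x => c * f x) z = c * dbar v f z := by
  simp only [dbar]
  rw [fderiv_const_mul hf]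
  simp only [smul_apply, smul_eq_mul]
  ring

/-- `∂̄` of the product of a holomorphic function with another function. -/
theorem dbar_mul_of_holomorphic {v : E} {f g : E → ℂ} {z : E} (hf : DifferentiableAt ℂ f z)
    (hg : DifferentiableAt ℝ g z) : dbar v (fun x => f x * g x) z = f z * dbar v g z := by
  have h1 := hf.hasFDerivAt.restrictScalars ℝ
  simp only [dbar]
  rw [fderiv_fun_mul h1.differentiableAt hg, h1.fderiv]
  simp only [add_apply, smul_apply, smul_eq_mul, ContinuousLinearMap.coe_restrictScalars', map_smul]
  linear_combination (g z * fderiv ℂ f z v / 2) * Complex.I_sq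

theorem dbar_const_sub {v : E} {g : E → ℂ} {z : E} (c : ℂ) :
    dbar v (fun x => c - g x) z = -dbar v g z := by
  simp only [dbar]
  rw [fderiv_const_sub]
  simp only [neg_apply]
  ring

theorem ContDiff.dbar {m k : WithTop ℕ∞} {g : E → ℂ} (hg : ContDiff ℝ k g) (hm : m + 1 ≤ k)
    (v : E) : ContDiff ℝ m (dbar v g) := by
  have h := hg.fderiv_right hm
  unfold _root_.dbar
  exact ((h.clm_apply contDiff_const).add
    (contDiff_const.mul (h.clm_apply contDiff_const))).div_const _

theorem dbar_comm {g : E → ℂ} (hg : ContDiff ℝ 2 g) (v w z : E) :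
    dbar v (dbar w g) z = dbar w (dbar v g) z := by
  have hD : DifferentiableAt ℝ (fderiv ℝ g) z :=
    (hg.fderiv_right (m := 1) le_rfl).differentiable one_ne_zero z
  have hsymm := hg.contDiffAt (x := z) |>.isSymmSndFDerivAt (by simp)
  have key : ∀ a b : E, fderiv ℝ (dbar a g) z b = (fderiv ℝ (fderiv ℝ g) z b a
      + Complex.I * fderiv ℝ (fderiv ℝ g) z b (Complex.I • a)) / 2 := by
    intro a b
    have h1 : ∀ c : E, HasFDerivAt (fun x => fderiv ℝ g x c)
        ((ContinuousLinearMap.apply ℝ ℂ c).comp (fderiv ℝ (fderiv ℝ g) z)) z := fun c =>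
      (ContinuousLinearMap.apply ℝ ℂ c).hasFDerivAt.comp z hD.hasFDerivAt
    have h2 := ((h1 a).add ((h1 (Complex.I • a)).const_mul Complex.I)).mul_const (2⁻¹ : ℂ)
    have h3 : dbar a g = fun x =>
        (fderiv ℝ g x a + Complex.I * fderiv ℝ g x (Complex.I • a)) * 2⁻¹ := by
      ext x; rw [dbar, div_eq_mul_inv]
    have h4 : HasFDerivAt (fun x =>
        (fderiv ℝ g x a + Complex.I * fderiv ℝ g x (Complex.I • a)) * 2⁻¹) _ z := h2
    rw [h3, h4.fderiv]
    simp
    ring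
  rw [dbar, dbar, key, key, key, key, hsymm v w, hsymm v (Complex.I • w), hsymm (Complex.I • v) w,
    hsymm (Complex.I • v) (Complex.I • w)]
  ring

end dbar

variable {n : ℕ}

/-- **Hartogs' extension theorem**. -/
theorem exists_holomorphic_extension (hn : 2 ≤ n) {Ω L₀ : Set (Fin n → ℂ)} (hΩ : IsOpen Ω)
    (hL₀ : IsCompact L₀) (hne : L₀.Nonempty) (hsub : L₀ ⊆ Ω) (hconn : IsPreconnected (Ω \ L₀))
    {f : (Fin n → ℂ) → ℂ} (hf : DifferentiableOn ℂ f (Ω \ L₀)) :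
    ∃ F, DifferentiableOn ℂ F Ω ∧ ∀ z ∈ Ω \ L₀, F z = f z := by
  have hD : IsOpen (Ω \ L₀) := hΩ.sdiff hL₀.isClosed
  obtain ⟨L, hL, hL₀L, hLΩ⟩ := exists_compact_between hL₀ hΩ hsub
  obtain ⟨χ₀, hχ1, hχ0, -⟩ := exists_contMDiffMap_one_nhds_of_subset_interior
    (modelWithCornersSelf ℝ (Fin n → ℂ)) (n := 2) hL₀.isClosed hL₀L
  let χ : (Fin n → ℂ) → ℂ := fun z => (χ₀ z : ℂ)
  have hχ : ContDiff ℝ 2 χ :=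
    Complex.ofRealCLM.contDiff.comp (contMDiff_iff_contDiff.1 χ₀.contMDiff)
  have hχL₀ : ∀ z ∈ L₀, χ =ᶠ[𝓝 z] fun _ => 1 := fun z hz => by
    filter_upwards [eventually_nhdsSet_iff_forall.1 hχ1 z hz] with w hw
    simp [χ, hw]
  have hχL : ∀ z ∉ L, χ =ᶠ[𝓝 z] fun _ => 0 := fun z hz => by
    filter_upwards [hL.isClosed.isOpen_compl.mem_nhds hz] with w hw
    simp [χ, hχ0 w hw]
  -- These are the components of ∂̄(fχ) off `L₀`. They vanish near `L₀` and off `L`, where χ is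
  -- locally constant, so they are smooth everywhere whatever values `f` takes on `L₀`.
  let φ : (Fin n → ℂ) → (Fin n → ℂ) → ℂ := fun v z => f z * dbar v χ z
  have hdconst : ∀ (v z : Fin n → ℂ) (c : ℂ), (χ =ᶠ[𝓝 z] fun _ => c) →
      φ v =ᶠ[𝓝 z] 0 := by
    intro v z c h
    filter_upwards [h.eventuallyEq_nhds] with w hw
    simp only [φ, Pi.zero_apply]
    rw [dbar_congr hw, dbar]
    simp
  have hcases : ∀ z, z ∈ Ω \ L₀ ∨ ∀ v, φ v =ᶠ[𝓝 z] 0 := by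
    intro z
    by_cases h1 : z ∈ L₀
    · exact Or.inr fun v => hdconst v z 1 (hχL₀ z h1)
    · by_cases h2 : z ∈ L
      · exact Or.inl ⟨hLΩ h2, h1⟩
      · exact Or.inr fun v => hdconst v z 0 (hχL z h2)
  have hfsm : ContDiffOn ℝ 1 f (Ω \ L₀) := (hf.contDiffOn_of_complex hD 1).restrict_scalars ℝ
  have hdχ : ∀ v, ContDiff ℝ 1 (dbar v χ) := fun v => hχ.dbar le_rfl v
  have hφ : ∀ v, ContDiff ℝ 1 (φ v) := by
    intro v
    rw [contDiff_iff_contDiffAt]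
    intro z
    rcases hcases z with h | h
    · exact (hfsm.contDiffAt (hD.mem_nhds h)).mul (hdχ v).contDiffAt
    · exact (contDiffAt_const (c := (0 : ℂ))).congr_of_eventuallyEq (h v)
  have hφL : ∀ v, ∀ z ∉ L, φ v z = 0 := fun v z hz =>
    (hdconst v z 0 (hχL z hz)).self_of_nhds
  have hφc : ∀ v, HasCompactSupport (φ v) := fun v => HasCompactSupport.intro hL (hφL v)
  have hcompat : ∀ v e z, dbar v (φ e) z = dbar e (φ v) z := by
    intro v e z
    rcases hcases z with h | h
    · have hfz := hf.differentiableAt (hD.mem_nhds h)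
      simp only [φ]
      rw [dbar_mul_of_holomorphic hfz ((hdχ e).differentiable one_ne_zero z),
        dbar_mul_of_holomorphic hfz ((hdχ v).differentiable one_ne_zero z), dbar_comm hχ]
    · rw [dbar_eq_zero_of_eventuallyEq_zero (h e), dbar_eq_zero_of_eventuallyEq_zero (h v)]
  let i₀ : Fin n := ⟨0, by omega⟩
  let i₁ : Fin n := ⟨1, by omega⟩
  have hi : i₁ ≠ i₀ := by simp [i₀, i₁]
  let e : Fin n → ℂ := Pi.single i₀ 1
  have he : ‖e‖ = 1 := by simp only [e, Pi.norm_single, norm_one]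
  have hu : ∀ v z, dbar v (cauchyTransform e (φ e)) z = Real.pi * φ v z := fun v z =>
    dbar_cauchyTransform (hφ e) (hφc e) (hφ v) (hφc v) he (hcompat v e) z
  have hud : Differentiable ℝ (cauchyTransform e (φ e)) := fun z =>
    (hasFDerivAt_cauchyTransform (hφ e) (hφc e) he z).2.differentiableAt
  have hpi : (Real.pi : ℂ) ≠ 0 := by exact_mod_cast Real.pi_ne_zero
  let g : (Fin n → ℂ) → ℂ := fun z => f z * (1 - χ z)
  have hg : ∀ z ∈ Ω, DifferentiableAt ℝ g z ∧ ∀ v, dbar v g z = -φ v z := by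
    intro z hz
    by_cases h : z ∈ L₀
    · have h0 : g =ᶠ[𝓝 z] 0 := by
        filter_upwards [hχL₀ z h] with w hw
        simp [g, hw]
      refine ⟨(differentiableAt_const (0 : ℂ)).congr_of_eventuallyEq h0, fun v => ?_⟩
      rw [dbar_eq_zero_of_eventuallyEq_zero h0, (hdconst v z 1 (hχL₀ z h)).self_of_nhds]
      simp
    · have hfz := hf.differentiableAt (hD.mem_nhds ⟨hz, h⟩)
      have hχz : DifferentiableAt ℝ (fun z => 1 - χ z) z :=
        (differentiableAt_const _).sub (hχ.differentiable two_ne_zero z)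
      refine ⟨(hfz.hasFDerivAt.restrictScalars ℝ).differentiableAt.mul hχz, fun v => ?_⟩
      rw [dbar_mul_of_holomorphic hfz hχz, dbar_const_sub, mul_neg]
  -- The cut-off function f(1 - χ) has ∂̄ equal to -φ on `Ω`, and the Cauchy transform cancels this.
  let F : (Fin n → ℂ) → ℂ := fun z => g z + (Real.pi : ℂ)⁻¹ * cauchyTransform e (φ e) z
  have hF : DifferentiableOn ℂ F Ω := by
    intro z hz
    obtain ⟨hgz, hgd⟩ := hg z hz
    refine (differentiableAt_complex_of_dbar_eq_zero
      (hgz.fun_add ((hud z).const_mul _)) fun v => ?_).differentiableWithinAt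
    rw [dbar_add hgz ((hud z).const_mul _), dbar_const_mul _ (hud z), hgd, hu,
      inv_mul_cancel_left₀ hpi, neg_add_cancel]
  refine ⟨F, hF, ?_⟩
  have hLne : L.Nonempty := hne.mono (hL₀L.trans interior_subset)
  -- A second coordinate is needed here: the lines of integration keep coordinate `i₁` fixed, so
  -- where its real part exceeds the maximum over `L` they miss `L`. There the transform and χ
  -- vanish, so F = f. A point `q` of `Ω` just beyond `p` starts the identity theorem.
  obtain ⟨p, hpL, hpmax⟩ := hL.exists_isMaxOn hLne
    (f := fun z : Fin n → ℂ => (z i₁).re) (by fun_prop)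
  have hFf : ∀ z ∈ Ω, (p i₁).re < (z i₁).re → F z = f z := by
    intro z hz hlt
    have hout : ∀ ζ : ℂ, z - ζ • e ∉ L := by
      intro ζ hζ
      have := hpmax hζ
      have h2 : ((z - ζ • e) i₁).re = (z i₁).re := by simp [e, hi]
      simp only [mem_ofPred_eq] at this
      rw [h2] at this
      linarith
    have h0 : cauchyTransform e (φ e) z = 0 := by
      rw [cauchyTransform]
      simp_rw [fun ζ : ℂ => hφL e _ (hout ζ), mul_zero]
      simp
    have hzL : z ∉ L := by simpa using hout 0
    have h1 : χ z = 0 := (hχL z hzL).self_of_nhds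
    simp only [F, g]
    rw [h0, h1]; ring
  obtain ⟨ε, hε, hball⟩ := Metric.isOpen_iff.1 hΩ p (hLΩ hpL)
  let q : Fin n → ℂ := p + ((ε / 2 : ℝ) : ℂ) • Pi.single i₁ 1
  have hqΩ : q ∈ Ω := by
    apply hball
    rw [mem_ball, dist_eq_norm]
    simp only [q, add_sub_cancel_left, norm_smul, Complex.norm_real, Pi.norm_single, norm_one,
      mul_one]
    rw [Real.norm_of_nonneg (by positivity)]; linarith
  have hqre : (p i₁).re < (q i₁).re := by
    simp only [q, Pi.add_apply, Pi.smul_apply, Pi.single_eq_same, smul_eq_mul, mul_one,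
      Complex.add_re, Complex.ofReal_re]
    linarith
  have hqD : q ∈ Ω \ L₀ := by
    refine ⟨hqΩ, fun h => ?_⟩
    have := hpmax (hL₀L.trans interior_subset h)
    simp only [mem_ofPred_eq] at this
    linarith
  have hdiff := ((hF.mono sdiff_subset).sub hf).eqOn_zero_of_eventuallyEq_zero hD hconn hqD (by
    have h1 : ∀ᶠ z in 𝓝 q, (p i₁).re < (z i₁).re :=
      (by fun_prop : Continuous fun z : Fin n → ℂ => (z i₁).re).continuousAt.eventually_const_lt hqre
    filter_upwards [h1, hΩ.mem_nhds hqΩ] with z hz hzΩ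
    simp [hFf z hzΩ hz])
  exact fun z hz => sub_eq_zero.1 (hdiff z hz)

end Hartogs

/-! ### The Bergman metric as a normalized distance in the dual. -/

section MinimalForm

open InnerProductSpace
open scoped InnerProductSpace ComplexConjugate

/-- The Gram quotient of two vectors is the squared distance of the second to the line spanned by
the first, divided by the squared norm of the first. -/
theorem exists_gram_div_eq_norm_sub_smul {H : Type*} [NormedAddCommGroup H] [InnerProductSpace ℂ H]
    {φ : H} (hφ : φ ≠ 0) (ψ : H) :
    ∃ b : ℂ, (‖φ‖ ^ 2 * ‖ψ‖ ^ 2 - ‖⟪φ, ψ⟫_ℂ‖ ^ 2) / (‖φ‖ ^ 2) ^ 2 = (‖ψ - b • φ‖ / ‖φ‖) ^ 2 ∧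
      ∀ c : ℂ, ‖ψ - b • φ‖ ≤ ‖ψ - c • φ‖ := by
  have hn : 0 < ‖φ‖ := norm_pos_iff.2 hφ
  have hself : ⟪φ, φ⟫_ℂ = (‖φ‖ : ℂ) ^ 2 := inner_self_eq_norm_sq_to_K φ
  have hnc : (‖φ‖ : ℂ) ≠ 0 := by exact_mod_cast hn.ne'
  -- Coefficient of the orthogonal projection of ψ onto the line of φ.
  set b : ℂ := ⟪φ, ψ⟫_ℂ / (‖φ‖ : ℂ) ^ 2 with hb
  have horth : ∀ c : ℂ, ⟪ψ - b • φ, c • φ⟫_ℂ = 0 := by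
    intro c
    rw [← inner_conj_symm, inner_smul_left, inner_sub_right, inner_smul_right, hself, hb,
      div_mul_cancel₀ _ (pow_ne_zero 2 hnc), sub_self, mul_zero, map_zero]
  have hpyth : ∀ c : ℂ, ‖ψ - b • φ + c • φ‖ ^ 2 = ‖ψ - b • φ‖ ^ 2 + ‖c • φ‖ ^ 2 := fun c => by
    have := norm_add_sq_eq_norm_sq_add_norm_sq_of_inner_eq_zero (𝕜 := ℂ) _ _ (horth c)
    simpa only [← pow_two] using this
  refine ⟨b, ?_, fun c => ?_⟩
  · have h1 := hpyth b
    rw [sub_add_cancel] at h1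
    have h2 : ‖b • φ‖ ^ 2 = ‖⟪φ, ψ⟫_ℂ‖ ^ 2 / ‖φ‖ ^ 2 := by
      rw [norm_smul, hb, norm_div, norm_pow, Complex.norm_real, norm_norm]
      field_simp
    rw [h2] at h1
    rw [div_pow, h1]
    field_simp
    ring
  · have h1 := hpyth (b - c)
    have h2 : ψ - b • φ + (b - c) • φ = ψ - c • φ := by rw [sub_smul]; abel
    rw [h2] at h1
    refine abs_le_of_sq_le_sq' ?_ (norm_nonneg _) |>.2
    nlinarith [sq_nonneg ‖(b - c) • φ‖]

/-- The Riesz map is a conjugate-linear isometry, so the distance formula passes to functionals.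
These can be pulled back along restriction maps. -/
theorem exists_gram_rieszReal_div_eq {H : Type*} [NormedAddCommGroup H] [InnerProductSpace ℂ H]
    [CompleteSpace H] {L : StrongDual ℂ H} (hL : L ≠ 0) (M : StrongDual ℂ H) :
    ∃ a : ℂ, (‖rieszReal H L‖ ^ 2 * ‖rieszReal H M‖ ^ 2
        - ‖⟪rieszReal H L, rieszReal H M⟫_ℂ‖ ^ 2) / (‖rieszReal H L‖ ^ 2) ^ 2
        = (‖M - a • L‖ / ‖L‖) ^ 2 ∧
      ∀ c : ℂ, ‖M - a • L‖ ≤ ‖M - c • L‖ := by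
  have h0 : rieszReal H L ≠ 0 := by
    rw [← norm_ne_zero_iff, norm_rieszReal, norm_ne_zero_iff]; exact hL
  obtain ⟨b, hbeq, hmin⟩ := exists_gram_div_eq_norm_sub_smul h0 (rieszReal H M)
  have key : ∀ c : ℂ, ‖M - c • L‖ = ‖rieszReal H M - conj c • rieszReal H L‖ := by
    intro c
    rw [← norm_rieszReal, map_sub, rieszReal_smul]
  refine ⟨conj b, ?_, fun c => ?_⟩
  · rw [key, Complex.conj_conj, ← norm_rieszReal L]
    exact hbeq
  · rw [key, key, Complex.conj_conj]
    exact hmin _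

variable {n : ℕ} {Ω : Set (Fin n → ℂ)} [CompleteSpace (bergmanSubmodule Ω)]

/-- The Bergman metric is the normalized distance of the derivative of the evaluation functional to
the line spanned by the evaluation functional. -/
theorem exists_bergmanMetric_eq (hΩ : IsOpen Ω) (hb : Bornology.IsBounded Ω) {z : Fin n → ℂ}
    (hz : z ∈ Ω) (ξ : Fin n → ℂ) :
    ∃ a : ℂ, bergmanMetric Ω z ξ
        = ‖fderiv ℂ (bergmanEval hΩ) z ξ - a • bergmanEval hΩ z‖ / ‖bergmanEval hΩ z‖ ∧
      ∀ c : ℂ, ‖fderiv ℂ (bergmanEval hΩ) z ξ - a • bergmanEval hΩ z‖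
        ≤ ‖fderiv ℂ (bergmanEval hΩ) z ξ - c • bergmanEval hΩ z‖ := by
  obtain ⟨a, ha, hmin⟩ := exists_gram_rieszReal_div_eq (bergmanEval_ne_zero hΩ hb hz)
    (fderiv ℂ (bergmanEval hΩ) z ξ)
  refine ⟨a, ?_, hmin⟩
  rw [bergmanMetric, leviForm_logBergman hΩ hb hz]
  exact (congrArg Real.sqrt ha).trans (Real.sqrt_sq (by positivity))

theorem bergmanMetric_le (hΩ : IsOpen Ω) (hb : Bornology.IsBounded Ω) {z : Fin n → ℂ}
    (hz : z ∈ Ω) (ξ : Fin n → ℂ) (a : ℂ) :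
    bergmanMetric Ω z ξ
      ≤ ‖fderiv ℂ (bergmanEval hΩ) z ξ - a • bergmanEval hΩ z‖ / ‖bergmanEval hΩ z‖ := by
  obtain ⟨b, hbeq, hmin⟩ := exists_bergmanMetric_eq hΩ hb hz ξ
  rw [hbeq]
  gcongr
  exact hmin a

end MinimalForm

/-! ### Restriction between Bergman spaces and comparison of metrics. -/

section Restriction

open Set Filter
open scoped Topology

theorem fderiv_strongDual_comp {E X Y : Type*} [NormedAddCommGroup E] [NormedSpace ℂ E]
    [NormedAddCommGroup X] [NormedSpace ℂ X] [NormedAddCommGroup Y] [NormedSpace ℂ Y]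
    {e : E → StrongDual ℂ Y} {z : E} (he : DifferentiableAt ℂ e z) (T : X →L[ℂ] Y) (ξ : E) :
    fderiv ℂ (fun w => (e w).comp T) z ξ = (fderiv ℂ e z ξ).comp T := by
  have h := ((ContinuousLinearMap.compL ℂ X Y ℂ).flip T).hasFDerivAt.comp z he.hasFDerivAt
  have h' : HasFDerivAt (fun w => (e w).comp T) _ z := h
  rw [h'.fderiv]; rfl

variable {n : ℕ} {Ω D : Set (Fin n → ℂ)}

theorem bergmanSubmodule_ext (hΩ : IsOpen Ω) {g h : bergmanSubmodule Ω}
    (H : ∀ z ∈ Ω, bergmanEval hΩ z g = bergmanEval hΩ z h) : g = h := by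
  refine Subtype.ext (Lp.ext ?_)
  refine (bergmanRep_ae_eq g).symm.trans (EventuallyEq.trans ?_ (bergmanRep_ae_eq h))
  filter_upwards [ae_restrict_mem hΩ.measurableSet] with z hz
  rw [← bergmanEval_apply hΩ hz, ← bergmanEval_apply hΩ hz, H z hz]

theorem bergmanSpace_mono (hDΩ : D ⊆ Ω) : bergmanSpace Ω ⊆ bergmanSpace D := fun _ hf =>
  ⟨hf.1.mono hDΩ, hf.2.mono_measure (Measure.restrict_mono hDΩ le_rfl)⟩

theorem norm_toBergman_sq {f : (Fin n → ℂ) → ℂ} (hf : f ∈ bergmanSpace Ω) :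
    ‖toBergman hf‖ ^ 2 = ∫ z in Ω, ‖f z‖ ^ 2 :=
  (setIntegral_norm_sq_eq_of_ae_eq (toBergman_ae_eq hf)).symm

/-- Restriction of square integrable holomorphic functions to a smaller open set. -/
def bergmanRestrict (hΩ : IsOpen Ω) (hD : IsOpen D) (hDΩ : D ⊆ Ω) :
    bergmanSubmodule Ω →L[ℂ] bergmanSubmodule D :=
  LinearMap.mkContinuous
    { toFun := fun g => toBergman (bergmanSpace_mono hDΩ (bergmanRep_mem g))
      map_add' := fun a b => bergmanSubmodule_ext hD fun z hz => by
        rw [map_add]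
        simp only [bergmanEval_toBergman hD hz]
        simp only [← bergmanEval_apply hΩ (hDΩ hz), map_add]
      map_smul' := fun c a => bergmanSubmodule_ext hD fun z hz => by
        rw [map_smul]
        simp only [bergmanEval_toBergman hD hz]
        simp only [← bergmanEval_apply hΩ (hDΩ hz), map_smul, RingHom.id_apply] } 1
    (fun g => by
      rw [one_mul]
      refine abs_le_of_sq_le_sq' ?_ (norm_nonneg g) |>.2
      refine (norm_toBergman_sq (bergmanSpace_mono hDΩ (bergmanRep_mem g))).trans_le ?_
      refine (setIntegral_mono_set
        ((memLp_two_iff_integrable_sq_norm (bergmanRep_mem g).2.1).1 (bergmanRep_mem g).2)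
        (Eventually.of_forall fun z => by positivity) hDΩ.eventuallyLE).trans_eq ?_
      exact setIntegral_norm_sq_eq_of_ae_eq (bergmanRep_ae_eq g))

theorem norm_bergmanRestrict_le (hΩ : IsOpen Ω) (hD : IsOpen D) (hDΩ : D ⊆ Ω) :
    ‖bergmanRestrict hΩ hD hDΩ‖ ≤ 1 :=
  LinearMap.mkContinuous_norm_le _ zero_le_one _

theorem bergmanEval_bergmanRestrict (hΩ : IsOpen Ω) (hD : IsOpen D) (hDΩ : D ⊆ Ω)
    {z : Fin n → ℂ} (hz : z ∈ D) (g : bergmanSubmodule Ω) :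
    bergmanEval hD z (bergmanRestrict hΩ hD hDΩ g) = bergmanEval hΩ z g :=
  (bergmanEval_toBergman hD hz (bergmanSpace_mono hDΩ (bergmanRep_mem g))).trans (bergmanEval_apply hΩ (hDΩ hz) g).symm

theorem bergmanEval_comp_bergmanRestrict (hΩ : IsOpen Ω) (hD : IsOpen D) (hDΩ : D ⊆ Ω)
    {z : Fin n → ℂ} (hz : z ∈ D) :
    (bergmanEval hD z).comp (bergmanRestrict hΩ hD hDΩ) = bergmanEval hΩ z :=
  ContinuousLinearMap.ext fun g => bergmanEval_bergmanRestrict hΩ hD hDΩ hz g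

theorem fderiv_bergmanEval_comp_bergmanRestrict (hΩ : IsOpen Ω) (hD : IsOpen D) (hDΩ : D ⊆ Ω)
    {z : Fin n → ℂ} (hz : z ∈ D) (ξ : Fin n → ℂ) :
    (fderiv ℂ (bergmanEval hD) z ξ).comp (bergmanRestrict hΩ hD hDΩ)
      = fderiv ℂ (bergmanEval hΩ) z ξ := by
  have h2 : bergmanEval hΩ =ᶠ[𝓝 z] fun w => (bergmanEval hD w).comp (bergmanRestrict hΩ hD hDΩ) := by
    filter_upwards [hD.mem_nhds hz] with w hw
    exact (bergmanEval_comp_bergmanRestrict hΩ hD hDΩ hw).symm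
  rw [h2.fderiv_eq]
  exact (fderiv_strongDual_comp ((bergmanEval_differentiableOn hD).differentiableAt
    (hD.mem_nhds hz)) _ ξ).symm

theorem bergmanRestrict_injective (hΩ : IsOpen Ω) (hΩc : IsPreconnected Ω) (hD : IsOpen D)
    (hDΩ : D ⊆ Ω) (hne : D.Nonempty) : Function.Injective (bergmanRestrict hΩ hD hDΩ) := by
  refine (injective_iff_map_eq_zero _).2 fun g hg => ?_
  obtain ⟨z₀, hz₀⟩ := hne
  have h0 : bergmanRep g =ᶠ[𝓝 z₀] 0 := by
    filter_upwards [hD.mem_nhds hz₀] with z hz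
    rw [← bergmanEval_apply hΩ (hDΩ hz), ← bergmanEval_bergmanRestrict hΩ hD hDΩ hz, hg, map_zero]
    rfl
  have h1 := (bergmanRep_differentiableOn g).eqOn_zero_of_eventuallyEq_zero hΩ hΩc (hDΩ hz₀) h0
  refine bergmanSubmodule_ext hΩ fun z hz => ?_
  rw [bergmanEval_apply hΩ hz, h1 z hz, map_zero]

/-- The Hartogs extension is square integrable because it is continuous on the added compact set. -/
theorem bergmanRestrict_surjective (hn : 2 ≤ n) (hΩ : IsOpen Ω) {L₀ : Set (Fin n → ℂ)}
    (hL₀ : IsCompact L₀) (hne : L₀.Nonempty) (hsub : L₀ ⊆ Ω) (hconn : IsPreconnected (Ω \ L₀))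
    (hD : IsOpen (Ω \ L₀)) :
    Function.Surjective (bergmanRestrict hΩ hD sdiff_subset) := by
  intro h
  obtain ⟨F, hF, hFh⟩ := exists_holomorphic_extension hn hΩ hL₀ hne hsub hconn
    (bergmanRep_differentiableOn h)
  have hmeas : AEStronglyMeasurable F (volume.restrict Ω) :=
    hF.continuousOn.aestronglyMeasurable hΩ.measurableSet
  have hmem : F ∈ bergmanSpace Ω := by
    refine ⟨hF, (memLp_two_iff_integrable_sq_norm hmeas).2 ?_⟩
    have h1 : IntegrableOn (fun z => ‖F z‖ ^ 2) (Ω \ L₀) := by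
      refine IntegrableOn.congr_fun (f := fun z => ‖bergmanRep h z‖ ^ 2) ?_
        (fun z hz => by simp only [hFh z hz]) hD.measurableSet
      exact (memLp_two_iff_integrable_sq_norm (bergmanRep_mem h).2.1).1 (bergmanRep_mem h).2
    have h2 : IntegrableOn (fun z => ‖F z‖ ^ 2) L₀ :=
      ((hF.continuousOn.mono hsub).norm.pow 2).integrableOn_compact hL₀
    have h3 := h1.union h2
    rwa [sdiff_union_of_subset hsub] at h3
  refine ⟨toBergman hmem, bergmanSubmodule_ext hD fun z hz => ?_⟩
  rw [bergmanEval_bergmanRestrict hΩ hD sdiff_subset hz, bergmanEval_toBergman hΩ hz.1, hFh z hz,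
    bergmanEval_apply hD hz]

/-- Bergman metrics are comparable when restriction is an isomorphism of Bergman spaces. -/
theorem exists_bergmanMetric_comparison [CompleteSpace (bergmanSubmodule Ω)]
    [CompleteSpace (bergmanSubmodule D)] (hΩ : IsOpen Ω) (hb : Bornology.IsBounded Ω)
    (hD : IsOpen D) (hDΩ : D ⊆ Ω) (hbij : Function.Bijective (bergmanRestrict hΩ hD hDΩ)) :
    ∃ C : ℝ, 0 ≤ C ∧ ∀ z ∈ D, ∀ ξ : Fin n → ℂ,
      bergmanMetric Ω z ξ ≤ C * bergmanMetric D z ξ ∧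
      bergmanMetric D z ξ ≤ C * bergmanMetric Ω z ξ := by
  have hbD : Bornology.IsBounded D := hb.subset hDΩ
  set T := bergmanRestrict hΩ hD hDΩ with hT
  -- Open mapping theorem: the inverse is bounded, and its norm is the comparison constant.
  let e : bergmanSubmodule Ω ≃L[ℂ] bergmanSubmodule D := ContinuousLinearEquiv.ofBijective T
    (LinearMap.ker_eq_bot.2 hbij.1) (LinearMap.range_eq_top.2 hbij.2)
  have he : ∀ h, T (e.symm h) = h := fun h => e.apply_symm_apply h
  set C : ℝ := ‖(e.symm : bergmanSubmodule D →L[ℂ] bergmanSubmodule Ω)‖ with hC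
  have hup : ∀ L : StrongDual ℂ (bergmanSubmodule D), ‖L.comp T‖ ≤ ‖L‖ := fun L =>
    (L.opNorm_comp_le T).trans
      (mul_le_of_le_one_right (norm_nonneg L) (norm_bergmanRestrict_le hΩ hD hDΩ))
  have hlow : ∀ L : StrongDual ℂ (bergmanSubmodule D), ‖L‖ ≤ C * ‖L.comp T‖ := fun L => by
    have h1 : L = (L.comp T).comp (e.symm : bergmanSubmodule D →L[ℂ] bergmanSubmodule Ω) :=
      ContinuousLinearMap.ext fun h => by
        rw [ContinuousLinearMap.comp_apply, ContinuousLinearMap.comp_apply]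
        exact congrArg L (he h).symm
    calc ‖L‖ = ‖(L.comp T).comp (e.symm : bergmanSubmodule D →L[ℂ] bergmanSubmodule Ω)‖ :=
          congrArg norm h1
      _ ≤ ‖L.comp T‖ * C := ContinuousLinearMap.opNorm_comp_le _ _
      _ = C * ‖L.comp T‖ := mul_comm _ _
  refine ⟨C, hC ▸ ContinuousLinearMap.opNorm_nonneg _, fun z hz ξ => ?_⟩
  have hcomb : ∀ a : ℂ, (fderiv ℂ (bergmanEval hD) z ξ - a • bergmanEval hD z).comp T
      = fderiv ℂ (bergmanEval hΩ) z ξ - a • bergmanEval hΩ z := fun a => by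
    rw [← fderiv_bergmanEval_comp_bergmanRestrict hΩ hD hDΩ hz,
      ← bergmanEval_comp_bergmanRestrict hΩ hD hDΩ hz]
    rfl
  have hLD : 0 < ‖bergmanEval hD z‖ :=
    (norm_pos_iff (a := bergmanEval hD z)).2 (bergmanEval_ne_zero hD hbD hz)
  have hLΩ : 0 < ‖bergmanEval hΩ z‖ :=
    (norm_pos_iff (a := bergmanEval hΩ z)).2 (bergmanEval_ne_zero hΩ hb (hDΩ hz))
  have h1 : ‖bergmanEval hΩ z‖ ≤ ‖bergmanEval hD z‖ := by
    rw [← bergmanEval_comp_bergmanRestrict hΩ hD hDΩ hz]; exact hup _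
  have h2 : ‖bergmanEval hD z‖ ≤ C * ‖bergmanEval hΩ z‖ := by
    rw [← bergmanEval_comp_bergmanRestrict hΩ hD hDΩ hz]; exact hlow _
  constructor
  -- The minimizing scalar for one domain is a competitor for the other. Here the numerator only
  -- shrinks under pullback and the denominator costs `C`; in the other direction the roles are
  -- exchanged.
  · obtain ⟨a, ha, -⟩ := exists_bergmanMetric_eq hD hbD hz ξ
    refine (bergmanMetric_le hΩ hb (hDΩ hz) ξ a).trans ?_
    rw [ha, ← hcomb]
    have h3 := hup (fderiv ℂ (bergmanEval hD) z ξ - a • bergmanEval hD z)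
    rw [← mul_div_assoc, div_le_div_iff₀ hLΩ hLD]
    calc _ ≤ ‖fderiv ℂ (bergmanEval hD) z ξ - a • bergmanEval hD z‖
          * (C * ‖bergmanEval hΩ z‖) := by gcongr
      _ = _ := by ring
  · obtain ⟨a, ha, -⟩ := exists_bergmanMetric_eq hΩ hb (hDΩ hz) ξ
    refine (bergmanMetric_le hD hbD hz ξ a).trans ?_
    rw [ha, ← hcomb, ← mul_div_assoc]
    have h3 := hlow (fderiv ℂ (bergmanEval hD) z ξ - a • bergmanEval hD z)
    gcongr

/-- The logarithmic derivative of a nonvanishing holomorphic map is bounded on compact sets. -/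
theorem exists_norm_fderiv_div_le_of_isCompact {E F : Type*} [NormedAddCommGroup E]
    [NormedSpace ℂ E] [FiniteDimensional ℂ E] [NormedAddCommGroup F] [NormedSpace ℂ F]
    {e : E → StrongDual ℂ F} {U L : Set E} (hU : IsOpen U) (he : DifferentiableOn ℂ e U)
    (h0 : ∀ z ∈ U, e z ≠ 0) (hL : IsCompact L) (hLU : L ⊆ U) :
    ∃ C : ℝ, ∀ z ∈ L, ∀ ξ, ‖fderiv ℂ e z ξ‖ / ‖e z‖ ≤ C * ‖ξ‖ := by
  have hsm : ContDiffOn ℂ 1 e U := he.contDiffOn_of_complex hU 1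
  have hcont : ContinuousOn (fun z => ‖fderiv ℂ e z‖ / ‖e z‖) L :=
    ((hsm.continuousOn_fderiv_of_isOpen hU le_rfl).norm.div hsm.continuousOn.norm
      fun z hz => norm_ne_zero_iff.2 (h0 z hz)).mono hLU
  obtain ⟨C, hC⟩ := hL.exists_bound_of_continuousOn hcont
  refine ⟨C, fun z hz ξ => ?_⟩
  calc _ ≤ ‖fderiv ℂ e z‖ * ‖ξ‖ / ‖e z‖ := by
        gcongr
        exact (fderiv ℂ e z).le_opNorm ξ
    _ = ‖fderiv ℂ e z‖ / ‖e z‖ * ‖ξ‖ := by ring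
    _ ≤ C * ‖ξ‖ := by
        gcongr
        exact (le_abs_self _).trans (hC z hz)

/-- The Bergman metric is bounded on compact sets. -/
theorem exists_bergmanMetric_le_of_isCompact [CompleteSpace (bergmanSubmodule Ω)] (hΩ : IsOpen Ω)
    (hb : Bornology.IsBounded Ω) {L : Set (Fin n → ℂ)} (hL : IsCompact L) (hLΩ : L ⊆ Ω) :
    ∃ C : ℝ, ∀ z ∈ L, ∀ ξ : Fin n → ℂ, bergmanMetric Ω z ξ ≤ C * ‖ξ‖ := by
  obtain ⟨C, hC⟩ := exists_norm_fderiv_div_le_of_isCompact hΩ (bergmanEval_differentiableOn hΩ)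
    (fun z hz => bergmanEval_ne_zero hΩ hb hz) hL hLΩ
  -- The competitor 0 leaves the logarithmic derivative of evaluation.
  refine ⟨C, fun z hz ξ => (bergmanMetric_le hΩ hb (hLΩ hz) ξ 0).trans ?_⟩
  have h0 : fderiv ℂ (bergmanEval hΩ) z ξ - (0 : ℂ) • bergmanEval hΩ z
      = fderiv ℂ (bergmanEval hΩ) z ξ := ContinuousLinearMap.ext fun g => by simp
  rw [h0]
  exact hC z hz ξ

end Restriction


end

/-! ### The comparison of the two Bergman metrics. -/

theorem proposition4p1 (n : ℕ) (hn : 2 ≤ n) (Ω K : Set (Fin n → ℂ))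
    (hΩo : IsOpen Ω) (hΩc : IsConnected Ω) (hΩb : Bornology.IsBounded Ω)
    (hKo : IsOpen K) (hKc : IsConnected K)
    (hKcpt : IsCompact (closure K)) (hKΩ : closure K ⊆ Ω)
    -- `Ω ∖ K` is a domain
    (hconn : IsConnected (Ω \ closure K)) :
    -- both metrics are well defined
    HasBergmanMetric Ω ∧ HasBergmanMetric (Ω \ closure K) ∧
    -- they are comparable
    (∃ d : ℝ, 0 < d ∧ d < 1 ∧
      ∀ z ∈ Ω \ closure K, ∀ ξ : Fin n → ℂ,
        Real.sqrt (1 - d ^ 2) * bergmanMetric Ω z ξ ≤ bergmanMetric (Ω \ closure K) z ξ ∧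
        bergmanMetric (Ω \ closure K) z ξ ≤ 1 / Real.sqrt (1 - d ^ 2) * bergmanMetric Ω z ξ) ∧
    -- no blow-up near the inner boundary
    (∃ U : Set (Fin n → ℂ), IsOpen U ∧ frontier K ⊆ U ∧
      ∃ C : ℝ, ∀ z ∈ U ∩ (Ω \ closure K), ∀ ξ : Fin n → ℂ,
        bergmanMetric (Ω \ closure K) z ξ ≤ C * ‖ξ‖) := by

  have hDo : IsOpen (Ω \ closure K) := hΩo.sdiff isClosed_closure
  have hDΩ : Ω \ closure K ⊆ Ω := Set.sdiff_subset
  have hbD : Bornology.IsBounded (Ω \ closure K) := hΩb.subset hDΩ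
  have := completeSpace_bergmanSubmodule hΩo
  have := completeSpace_bergmanSubmodule hDo
  have hbij : Function.Bijective (bergmanRestrict hΩo hDo hDΩ) :=
    ⟨bergmanRestrict_injective hΩo hΩc.isPreconnected hDo hDΩ hconn.nonempty,
      bergmanRestrict_surjective hn hΩo hKcpt hKc.nonempty.closure hKΩ hconn.isPreconnected hDo⟩
  obtain ⟨C₀, hC₀, hcomp⟩ := exists_bergmanMetric_comparison hΩo hΩb hDo hDΩ hbij
  -- Enlarged so that C > 1. With d = √(1 - C⁻²), which then lies in (0,1), the factor √(1 - d²) is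
  -- exactly C⁻¹.
  set C : ℝ := C₀ + 2 with hC
  have hmono : ∀ S z ξ, C₀ * bergmanMetric (n := n) S z ξ ≤ C * bergmanMetric S z ξ :=
    fun S z ξ => mul_le_mul_of_nonneg_right (by linarith) (Real.sqrt_nonneg _)
  have hCpos : 0 < C := by linarith
  have hinv : (C⁻¹) ^ 2 < 1 := by
    have : C⁻¹ < 1 := inv_lt_one_of_one_lt₀ (by linarith)
    have := inv_pos.2 hCpos
    nlinarith
  have hsq : Real.sqrt (1 - Real.sqrt (1 - (C⁻¹) ^ 2) ^ 2) = C⁻¹ := by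
    rw [Real.sq_sqrt (by linarith), sub_sub_cancel, Real.sqrt_sq (inv_pos.2 hCpos).le]
  refine ⟨hasBergmanMetric_of_isBounded hΩo hΩb, hasBergmanMetric_of_isBounded hDo hbD,
    ⟨Real.sqrt (1 - (C⁻¹) ^ 2), Real.sqrt_pos.2 (by linarith), ?_, fun z hz ξ => ?_⟩, ?_⟩
  · rw [Real.sqrt_lt' one_pos]
    have := pow_pos (inv_pos.2 hCpos) 2
    linarith
  · rw [hsq, one_div, inv_inv]
    obtain ⟨h1, h2⟩ := hcomp z hz ξ
    exact ⟨(inv_mul_le_iff₀ hCpos).2 (h1.trans (hmono _ _ _)), h2.trans (hmono _ _ _)⟩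
  · obtain ⟨L, hL, hKL, hLΩ⟩ := exists_compact_between hKcpt hΩo hKΩ
    obtain ⟨B, hB⟩ := exists_bergmanMetric_le_of_isCompact hΩo hΩb hL hLΩ
    refine ⟨interior L, isOpen_interior, frontier_subset_closure.trans hKL, C₀ * B,
      fun z hz ξ => ?_⟩
    refine (hcomp z hz.2 ξ).2.trans ?_
    rw [mul_assoc]
    exact mul_le_mul_of_nonneg_left (hB z (interior_subset hz.1) ξ) hC₀
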